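/- Let $\Pi$ be a non-empty profile (a finite list, possibly with repetitions) of rankings, i.e. complete orders, of a finite set $\mathcal C$ of candidates. The Kendall-Tau distance of two rankings is the number of pairs of candidates that they order differently; the Kemeny score of a ranking $\pi$ is the sum of the Kendall-Tau distances from $\pi$ to the rankings in $\Pi$; and $k_{\mathrm{OPT}}(\Pi)$ is the least Kemeny score of a ranking of $\mathcal C$. A ranking respects the unanimity order of $\Pi$ if it prefers $x$ to $y$ whenever all rankings in $\Pi$ do. The unanimity graph of $\Pi$ has vertex set $\mathcal C$, two distinct candidates being adjacent if all rankings in $\Pi$ order them in the same way; the unanimity width $w$ of $\Pi$ is the pathwidth of the complement of this graph. In the problem Distinct Approximate Kemeny Ranking Aggregation, the input consists of $\mathcal C$, $\Pi$, a rational approximation factor $\lambda\ge 1$ and an integer $r\ge 1$. Let $K$ be the set of the rankings of $\mathcal C$ that respect the unanimity order of $\Pi$ and have Kemeny score at most $\lambda\cdot k_{\mathrm{OPT}}(\Pi)$. The task is to output $\min\{r,|K|\}$ distinct rankings in $K$. Theorem. Distinct Approximate Kemeny Ranking Aggregation is fixed-parameter tractable in the combined parameter $(w,r)$. More precisely, there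 are an algorithm (a program of a random access machine with logarithmic cost), a constant $c$ and a polynomial $p$ such that the algorithm solves every instance in time at most $2^{c\,w}\cdot r\cdot p(N)$, where $N$ is the size of the instance in bits with all numbers written in binary; that is, the running time is $\mathcal O^*\big(2^{\mathcal O(w)}\cdot r\big)$. -/

import Mathlib

/-! ### Random access machine programs with logarithmic cost -/

namespace RAM

/-- A memory state: registers `reg x`, and one-way infinite arrays, the cell `i` of the array `a`
being `arr a i`.  A program names only finitely many registers and arrays. -/
structure State where
  reg : ℕ → ℕ
  arr : ℕ → ℕ → ℕ

/-- The arithmetical operations; subtraction is truncated, division rounds down. -/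
inductive BinOp
  | add
  | sub
  | mul
  | div

/-- The length of the binary representation (plus one, so that it is never zero). -/
def len (v : ℕ) : ℕ := Nat.size v + 1

def BinOp.eval : BinOp → ℕ → ℕ → ℕ
  | .add, a, b => a + b
  | .sub, a, b => a - b
  | .mul, a, b => a * b
  | .div, a, b => a / b

/-- The bit cost of an operation: linear in the lengths of the operands for addition and
subtraction, their product for multiplication and division. -/
def BinOp.cost : BinOp → ℕ → ℕ → ℕ
  | .add, a, b => len a + len b
  | .sub, a, b => len a + len b
  | .mul, a, b => len a * len b
  | .div, a, b => len a * len b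

/-- Expressions: constants, registers, array cells `load a e` (the cell of the array `a` whose
address is the value of `e`), and arithmetical operations. -/
inductive Expr
  | const (k : ℕ)
  | reg (x : ℕ)
  | load (a : ℕ) (e : Expr)
  | bin (o : BinOp) (e₁ e₂ : Expr)

def Expr.eval (s : State) : Expr → ℕ
  | .const k => k
  | .reg x => s.reg x
  | .load a e => s.arr a (e.eval s)
  | .bin o e₁ e₂ => o.eval (e₁.eval s) (e₂.eval s)

/-- The logarithmic cost of evaluating an expression: every value that is read, every address and
every operand is paid for by its length. -/
def Expr.cost (s : State) : Expr → ℕ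
  | .const k => len k
  | .reg x => len (s.reg x)
  | .load a e => e.cost s + len (e.eval s) + len (s.arr a (e.eval s))
  | .bin o e₁ e₂ => e₁.cost s + e₂.cost s + o.cost (e₁.eval s) (e₂.eval s)

/-- Programs. `set x e` writes the value of `e` to the register `x`; `store a i e` writes it to the
cell of the array `a` whose address is the value of `i`; tests are `e ≠ 0`. -/
inductive Prog
  | skip
  | set (x : ℕ) (e : Expr)
  | store (a : ℕ) (i e : Expr)
  | seq (P Q : Prog)
  | ite (e : Expr) (P Q : Prog)
  | loop (e : Expr) (P : Prog)

def State.setReg (s : State) (x v : ℕ) : State :=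
  { s with reg := Function.update s.reg x v }

def State.setArr (s : State) (a i v : ℕ) : State :=
  { s with arr := Function.update s.arr a (Function.update (s.arr a) i v) }

/-- `Exec P s s' t`: started in the state `s`, the program `P` halts in the state `s'`, and the
total cost of the executed instructions is `t`. -/
inductive Exec : Prog → State → State → ℕ → Prop
  | skip (s : State) : Exec .skip s s 1
  | set (x : ℕ) (e : Expr) (s : State) :
      Exec (.set x e) s (s.setReg x (e.eval s)) (e.cost s + 1)
  | store (a : ℕ) (i e : Expr) (s : State) :
      Exec (.store a i e) s (s.setArr a (i.eval s) (e.eval s)) (i.cost s + e.cost s + 1)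
  | seq {P Q : Prog} {s s' s'' : State} {t t' : ℕ} :
      Exec P s s' t → Exec Q s' s'' t' → Exec (.seq P Q) s s'' (t + t')
  | ite_true {e : Expr} {P Q : Prog} {s s' : State} {t : ℕ} :
      e.eval s ≠ 0 → Exec P s s' t → Exec (.ite e P Q) s s' (e.cost s + 1 + t)
  | ite_false {e : Expr} {P Q : Prog} {s s' : State} {t : ℕ} :
      e.eval s = 0 → Exec Q s s' t → Exec (.ite e P Q) s s' (e.cost s + 1 + t)
  | loop_done {e : Expr} {P : Prog} {s : State} :
      e.eval s = 0 → Exec (.loop e P) s s (e.cost s + 1)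
  | loop_step {e : Expr} {P : Prog} {s s' s'' : State} {t t' : ℕ} :
      e.eval s ≠ 0 → Exec P s s' t → Exec (.loop e P) s' s'' t' →
      Exec (.loop e P) s s'' (e.cost s + 1 + t + t')

/-- The initial state on the input `l`: `l` stands in the array `0`, all else is zero. -/
def start (l : List ℕ) : State where
  reg := fun _ => 0
  arr := fun a i => if a = 0 then l.getD i 0 else 0

/-- The word `l` stands at the beginning of the array `1`. -/
def State.Outputs (s : State) (l : List ℕ) : Prop :=
  ∀ i (h : i < l.length), s.arr 1 i = l[i]

/-- The number of bits of a list of numbers written in binary. -/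
def inputSize (l : List ℕ) : ℕ := (l.map len).sum

/-- A search problem: instances and candidate solutions, both encoded by lists of numbers, and the
correct solutions of each instance. -/
structure SearchProblem where
  Inst : Type
  Sol : Inst → Type
  Correct : ∀ I, Sol I → Prop
  encodeInst : Inst → List ℕ
  encodeSol : ∀ I, Sol I → List ℕ

namespace SearchProblem

/-- The input size of an instance, in bits. -/
def size (Q : SearchProblem) (I : Q.Inst) : ℕ := inputSize (Q.encodeInst I)

/-- On every instance `I`, the program `A` halts after time at most `T I` and outputs a correct
solution. -/
def SolvedInTime (Q : SearchProblem) (A : Prog) (T : Q.Inst → ℕ) : Prop :=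
  ∀ I : Q.Inst, ∃ (s : State) (t : ℕ), Exec A (start (Q.encodeInst I)) s t ∧ t ≤ T I ∧
    ∃ S : Q.Sol I, Q.Correct I S ∧ s.Outputs (Q.encodeSol I S)

/-- `A` solves the problem in time `O*(g)`: `g` times a polynomial in the input size. -/
def SolvedInOStar (Q : SearchProblem) (A : Prog) (g : Q.Inst → ℕ) : Prop :=
  ∃ p : Polynomial ℕ, Q.SolvedInTime A (fun I => g I * p.eval (Q.size I))

/-- `A` is a fixed-parameter algorithm in the combined parameter `κ`: its running time is
`f (κ I)` times a polynomial in the input size, for some computable `f`. -/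
def IsFPTAlgorithm (Q : SearchProblem) (A : Prog) (κ : Q.Inst → ℕ × ℕ) : Prop :=
  ∃ f : ℕ × ℕ → ℕ, Computable f ∧ Q.SolvedInOStar A (fun I => f (κ I))

end SearchProblem

end RAM

/-! ### Pathwidth -/

/-- A path decomposition with `t` bags. -/
structure PathDecomposition {V : Type} (G : SimpleGraph V) (t : ℕ) where
  bag : Fin t → Finset V
  cover : ∀ v, ∃ i, v ∈ bag i
  edge : ∀ u v, G.Adj u v → ∃ i, u ∈ bag i ∧ v ∈ bag i
  convex : ∀ i j k, i < j → j < k → ∀ v, v ∈ bag i → v ∈ bag k → v ∈ bag j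

/-- The width: the largest size of a bag, minus one (zero if all bags are empty). -/
def PathDecomposition.width {V : Type} {G : SimpleGraph V} {t : ℕ}
    (D : PathDecomposition G t) : ℕ :=
  (Finset.univ.sup fun i => (D.bag i).card) - 1

/-- The pathwidth: the minimum width of a path decomposition. -/
noncomputable def pathwidth {V : Type} (G : SimpleGraph V) : ℕ :=
  sInf {w | ∃ (t : ℕ) (D : PathDecomposition G t), D.width = w}

/-! ### Kemeny rankings -/

namespace Kemeny

/-- A ranking (complete order) of the candidates `0, …, m - 1`, given by the position of each
candidate; the most preferred candidate has position `0`. -/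
abbrev Ranking (m : ℕ) : Type := Equiv.Perm (Fin m)

/-- The candidate `a` is preferred to the candidate `b` in `π`. -/
abbrev Prefers {m : ℕ} (π : Ranking m) (a b : Fin m) : Prop := π a < π b

/-- The candidates from the most to the least preferred one. -/
def Ranking.toWord {m : ℕ} (π : Ranking m) : List ℕ :=
  List.ofFn fun p : Fin m => (π.symm p : ℕ)

/-- The Kendall-Tau distance: the number of pairs of candidates that `σ` and `τ` order differently
(each such pair is counted once, with the candidate that `σ` prefers written first). -/
def ktDist {m : ℕ} (σ τ : Ranking m) : ℕ :=
  (Finset.univ.filter fun q : Fin m × Fin m => Prefers σ q.1 q.2 ∧ Prefers τ q.2 q.1).card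

/-- A multiset of `n` rankings of `m` candidates, listed in some order. -/
abbrev Profile (m n : ℕ) : Type := Fin n → Ranking m

/-- The Kemeny score of `π` with respect to `R`. -/
def score {m n : ℕ} (R : Profile m n) (π : Ranking m) : ℕ := ∑ i, ktDist π (R i)

/-- The optimal Kemeny score of `R`. -/
noncomputable def optScore {m n : ℕ} (R : Profile m n) : ℕ := ⨅ π : Ranking m, score R π

/-- All votes prefer `a` to `b`. -/
def Unanimous {m n : ℕ} (R : Profile m n) (a b : Fin m) : Prop := ∀ i, Prefers (R i) a b

def RespectsUnanimity {m n : ℕ} (R : Profile m n) (π : Ranking m) : Prop :=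
  ∀ a b, Unanimous R a b → Prefers π a b

/-- The unanimity graph: two candidates are adjacent if all votes order them in the same way. -/
def unanimityGraph {m n : ℕ} (R : Profile m n) : SimpleGraph (Fin m) where
  Adj a b := a ≠ b ∧ (Unanimous R a b ∨ Unanimous R b a)
  symm := ⟨fun _ _ h => ⟨h.1.symm, h.2.symm⟩⟩
  loopless := ⟨fun _ h => h.1 rfl⟩

/-- The unanimity width: the pathwidth of the complement of the unanimity graph. -/
noncomputable def unanimityWidth {m n : ℕ} (R : Profile m n) : ℕ :=
  pathwidth (unanimityGraph R)ᶜ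

/-- An instance: a non-empty profile, a rational approximation factor `lam ≥ 1` and a positive
number `r` of rankings that are asked for. -/
structure Instance where
  m : ℕ
  n : ℕ
  votes : Profile m n
  lam : ℚ
  r : ℕ
  n_pos : 0 < n
  one_le_lam : 1 ≤ lam
  r_pos : 0 < r

namespace Instance

/-- The rankings that respect the unanimity order and have a Kemeny score of at most `lam` times
the optimal one. -/
def approxRankings (I : Instance) : Set (Ranking I.m) :=
  {π | RespectsUnanimity I.votes π ∧ (score I.votes π : ℚ) ≤ I.lam * (optScore I.votes : ℚ)}

/-- `L` lists, without repetition, approximate Kemeny rankings: `r` of them, or all of them if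
there are fewer than `r`. -/
def IsSolution (I : Instance) (L : List (Ranking I.m)) : Prop :=
  L.Nodup ∧ (∀ π ∈ L, π ∈ I.approxRankings) ∧ L.length = min I.r I.approxRankings.ncard

/-- An instance as a list of numbers: the parameters, and the votes one after the other. -/
def encode (I : Instance) : List ℕ :=
  [I.m, I.n, I.r, I.lam.num.toNat, I.lam.den] ++
    (List.ofFn fun i => Ranking.toWord (I.votes i)).flatten

end Instance

/-- Distinct approximate Kemeny ranking aggregation. The output consists of the number of rankings
in the list, and the rankings one after the other. -/
def distinctApproxKemeny : RAM.SearchProblem where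
  Inst := Instance
  Sol I := List (Ranking I.m)
  Correct I L := I.IsSolution L
  encodeInst I := I.encode
  encodeSol _ L := L.length :: (L.map Ranking.toWord).flatten

end Kemeny

/-! Let `W a b` be the number of votes preferring `a` to `b`. Rank the candidates one after the
other; putting `c` after the set `D` gains `∑ a ∈ D, W a c` agreements with the votes. Each vote
agrees or disagrees with a ranking on each of the `m * (m - 1) / 2` pairs, so total gain plus Kemeny
score is constant (`gainSum_add_score`), and a small score is a large gain. For distinct candidates,
`W c a = 0` says that all votes prefer `a` to `c`; hence the words built by admissible steps are
exactly the rankings that respect the unanimity order (`path_toWord`). A dynamic program over the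
prefix sets computes the best gain of each. Swapping a pair that is ranked against unanimity lowers
the score (`ktDist_swap_lt`), so optimal rankings respect unanimity, and the entry of the full set
yields the true optimum.

The number of prefix sets is controlled by the width. Each is closed under unanimous predecessors,
hence determined by its maximal elements; these are pairwise incomparable, that is, a clique in the
complement of the unanimity graph. A clique lies in a single bag of a path decomposition, and it
suffices to consider the last bag of each candidate, which gives at most `m * 2 ^ (w + 1) + 1` sets
(`card_cliques_le`, `length_le_of_reachable`).

The rankings are then listed backwards, by prepending letters to suffixes. The table decides whether
a suffix can be completed to a good ranking (`cons_suffix_iff`), so there are no dead ends: every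
suffix kept has an extension, and cutting each level to `r` suffixes loses nothing that is needed
(`LevelInv.next`). The table costs a polynomial times `2 ^ w`, the enumeration a polynomial times
`r`.

For the machine model, all memory cells are kept below `2 ^ B` with `B` quadratic in the input size.
An elementary instruction then costs `O(B ^ 2)`, and it remains to count instructions in a program
logic (`Ev`) with a rule for counting loops. -/

namespace RAM

/-! ### Cost of expressions over bounded memory -/

/-- All memory cells hold numbers below `2 ^ B`. -/
structure Good (B : ℕ) (s : State) : Prop where
  reg : ∀ x, s.reg x < 2 ^ B
  arr : ∀ a i, s.arr a i < 2 ^ B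

/-- The value of `e` has at most `e.bits * B` bits if all memory cells have at most `B` bits. -/
def Expr.bits : Expr → ℕ
  | .const k => k + 1
  | .reg _ => 1
  | .load _ _ => 1
  | .bin _ e₁ e₂ => e₁.bits + e₂.bits

/-- The cost of `e` is at most `e.factor * B ^ 2` if all memory cells have at most `B` bits. -/
def Expr.factor : Expr → ℕ
  | .const k => k + 2
  | .reg _ => 2
  | .load _ e => e.factor + (e.bits + 1) + 2
  | .bin _ e₁ e₂ => e₁.factor + e₂.factor +
      ((e₁.bits + 1) * (e₂.bits + 1) + (e₁.bits + 1) + (e₂.bits + 1))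

theorem len_le_of_lt {v d B : ℕ} (hB : 0 < B) (h : v < 2 ^ (d * B)) : len v ≤ (d + 1) * B := by
  have := Nat.size_le.2 h
  unfold len
  nlinarith

theorem Expr.eval_lt {B : ℕ} {s : State} (hB : 0 < B) (hs : Good B s) (e : Expr) :
    e.eval s < 2 ^ (e.bits * B) := by
  induction e with
  | const k =>
    exact lt_of_lt_of_le (Nat.lt_two_pow_self (n := k)) (Nat.pow_le_pow_right (by norm_num)
      (by simp only [Expr.bits]; nlinarith))
  | reg x => simpa [Expr.bits, Expr.eval] using hs.reg x
  | load a e _ => simpa [Expr.bits, Expr.eval] using hs.arr a _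
  | bin o e₁ e₂ h₁ h₂ =>
    -- For each of the four operations the result is below `(v₁ + 1) * (v₂ + 1)`, so the bounds on
    -- the numbers of bits add up.
    have key : (e₁.eval s + 1) * (e₂.eval s + 1) ≤ 2 ^ ((Expr.bin o e₁ e₂).bits * B) := by
      rw [Expr.bits, add_mul _ _ B, pow_add]
      exact Nat.mul_le_mul h₁ h₂
    have : o.eval (e₁.eval s) (e₂.eval s) < (e₁.eval s + 1) * (e₂.eval s + 1) := by
      cases o <;> simp only [BinOp.eval]
      · nlinarith
      · have := Nat.sub_le (e₁.eval s) (e₂.eval s)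
        nlinarith
      · nlinarith
      · have := Nat.div_le_self (e₁.eval s) (e₂.eval s)
        nlinarith
    exact lt_of_lt_of_le this key

/-- Lengths are linear in `B`; only multiplication and division charge a product of two lengths,
which makes the bound quadratic. -/
theorem Expr.cost_le {B : ℕ} {s : State} (hB : 0 < B) (hs : Good B s) (e : Expr) :
    e.cost s ≤ e.factor * B ^ 2 := by
  have hBB : B ≤ B ^ 2 := Nat.le_self_pow (by norm_num) B
  have L : ∀ e : Expr, len (e.eval s) ≤ (e.bits + 1) * B :=
    fun e => len_le_of_lt hB (e.eval_lt hB hs)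
  have L' : ∀ e : Expr, len (e.eval s) ≤ (e.bits + 1) * B ^ 2 :=
    fun e => (L e).trans (Nat.mul_le_mul_left _ hBB)
  induction e with
  | const k => exact L' (.const k)
  | reg x => exact L' (.reg x)
  | load a e ih =>
    have h1 := L' (.load a e)
    have h2 := L' e
    simp only [Expr.cost, Expr.factor, Expr.bits, Expr.eval] at *
    linarith
  | bin o e₁ e₂ h₁ h₂ =>
    have a1 := L e₁
    have a2 := L e₂
    have b1 := L' e₁
    have b2 := L' e₂
    have hm : len (e₁.eval s) * len (e₂.eval s) ≤ (e₁.bits + 1) * (e₂.bits + 1) * B ^ 2 :=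
      (Nat.mul_le_mul a1 a2).trans (le_of_eq (by ring))
    have hp : 0 ≤ (e₁.bits + 1) * (e₂.bits + 1) * B ^ 2 := Nat.zero_le _
    cases o <;> simp only [Expr.cost, Expr.factor, BinOp.cost] at * <;> linarith

/-! ### A program logic with time bounds -/

/-- The cost of an elementary instruction of the programs below, over memory cells of `B` bits. -/
def unitCost (B : ℕ) : ℕ := 1000 * B ^ 2

/-- Started in `s` over cells of `B` bits, `P` halts within `T` units of time, keeps the bound on
the cells, and establishes `Q`. -/
def Ev (B : ℕ) (P : Prog) (s : State) (T : ℕ) (Q : State → Prop) : Prop :=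
  Good B s → ∃ s' t, Exec P s s' t ∧ t ≤ T * unitCost B ∧ Good B s' ∧ Q s'

variable {B : ℕ} {s : State} {P P' : Prog} {T T' : ℕ} {Q Q' : State → Prop}

theorem Good.setReg (h : Good B s) {x v : ℕ} (hv : v < 2 ^ B) : Good B (s.setReg x v) := by
  refine ⟨fun y => ?_, h.arr⟩
  simp only [State.setReg, Function.update_apply]
  split_ifs
  · exact hv
  · exact h.reg y

theorem Good.setArr (h : Good B s) {a i v : ℕ} (hv : v < 2 ^ B) : Good B (s.setArr a i v) := by
  refine ⟨h.reg, fun b j => ?_⟩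
  simp only [State.setArr, Function.update_apply]
  split_ifs with h1
  · rw [Function.update_apply]
    split_ifs
    · exact hv
    · exact h.arr a j
  · exact h.arr b j

theorem Ev.mono (h : Ev B P s T Q) (hT : T ≤ T') (hQ : ∀ s', Q s' → Q' s') : Ev B P s T' Q' := by
  intro hs
  obtain ⟨s', t, h1, h2, h3, h4⟩ := h hs
  exact ⟨s', t, h1, h2.trans (Nat.mul_le_mul_right _ hT), h3, hQ _ h4⟩

theorem Ev.le (h : Ev B P s T Q) (hT : T ≤ T') : Ev B P s T' Q := h.mono hT fun _ => id

/-- The constant 1000 exceeds the factor of every expression in the programs, with room for the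
extra unit charged per instruction, as `1 ≤ B ^ 2`. -/
theorem add_one_le_unitCost {c f : ℕ} (hB : 0 < B) (hc : c ≤ f * B ^ 2) (hf : f < 1000) :
    c + 1 ≤ unitCost B := by
  have : 1 ≤ B ^ 2 := Nat.one_le_pow _ _ hB
  have h2 : (f + 1) * B ^ 2 ≤ unitCost B := Nat.mul_le_mul_right _ hf
  linarith

theorem Ev.skip (hB : 0 < B) (hQ : Q s) : Ev B .skip s 1 Q := fun hs =>
  ⟨s, 1, .skip s, by simpa using add_one_le_unitCost (c := 0) (f := 0) hB (by simp) (by norm_num),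
    hs, hQ⟩

theorem Ev.set {x : ℕ} {e : Expr} (hB : 0 < B) (hf : e.factor < 1000)
    (hv : Good B s → e.eval s < 2 ^ B) (hQ : Q (s.setReg x (e.eval s))) :
    Ev B (.set x e) s 1 Q := fun hs =>
  ⟨_, _, .set x e s, by simpa using add_one_le_unitCost hB (e.cost_le hB hs) hf,
    hs.setReg (hv hs), hQ⟩

theorem Ev.store {a : ℕ} {i e : Expr} (hB : 0 < B) (hf : i.factor + e.factor < 1000)
    (hv : Good B s → e.eval s < 2 ^ B) (hQ : Q (s.setArr a (i.eval s) (e.eval s))) :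
    Ev B (.store a i e) s 1 Q := fun hs =>
  ⟨_, _, .store a i e s, by
    simpa using add_one_le_unitCost hB
      ((Nat.add_le_add (i.cost_le hB hs) (e.cost_le hB hs)).trans_eq (add_mul _ _ _).symm) hf,
    hs.setArr (hv hs), hQ⟩

/-- The specification of the second program sits in the postcondition of the first, so that a proof
runs forward through the states. -/
theorem Ev.seq (h : Ev B P s T fun s' => Ev B P' s' T' Q) : Ev B (.seq P P') s (T + T') Q := by
  intro hs
  obtain ⟨s', t, h1, h2, h3, h4⟩ := h hs
  obtain ⟨s'', t', h1', h2', h3', h4'⟩ := h4 h3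
  exact ⟨s'', t + t', .seq h1 h1', by rw [add_mul]; exact Nat.add_le_add h2 h2', h3', h4'⟩

theorem Ev.setSeq {x : ℕ} {e : Expr} (hB : 0 < B) (hf : e.factor < 1000)
    (hv : Good B s → e.eval s < 2 ^ B) (h : Ev B P (s.setReg x (e.eval s)) T Q) :
    Ev B (.seq (.set x e) P) s (1 + T) Q :=
  Ev.seq (Ev.set hB hf hv h)

theorem Ev.storeSeq {a : ℕ} {i e : Expr} (hB : 0 < B) (hf : i.factor + e.factor < 1000)
    (hv : Good B s → e.eval s < 2 ^ B) (h : Ev B P (s.setArr a (i.eval s) (e.eval s)) T Q) :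
    Ev B (.seq (.store a i e) P) s (1 + T) Q :=
  Ev.seq (Ev.store hB hf hv h)

/-- Adding the bounds of both branches instead of taking their maximum keeps the time bounds free of
`max`, at the price of a constant. -/
theorem Ev.ite {e : Expr} (hB : 0 < B) (hf : e.factor < 1000)
    (h : e.eval s ≠ 0 → Ev B P s T Q) (h' : e.eval s = 0 → Ev B P' s T' Q) :
    Ev B (.ite e P P') s (1 + (T + T')) Q := by
  intro hs
  have hc := add_one_le_unitCost hB (e.cost_le hB hs) hf
  by_cases he : e.eval s = 0
  · obtain ⟨s', t, h1, h2, h3, h4⟩ := h' he hs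
    refine ⟨s', _, .ite_false he h1, ?_, h3, h4⟩
    have := Nat.zero_le (T * unitCost B)
    linarith
  · obtain ⟨s', t, h1, h2, h3, h4⟩ := h he hs
    refine ⟨s', _, .ite_true he h1, ?_, h3, h4⟩
    have := Nat.zero_le (T' * unitCost B)
    linarith

/-! ### Frames -/

/-- `P` may write to the register `x`. -/
def Prog.modReg (x : ℕ) : Prog → Bool
  | .skip => false
  | .set y _ => y == x
  | .store _ _ _ => false
  | .seq P Q => P.modReg x || Q.modReg x
  | .ite _ P Q => P.modReg x || Q.modReg x
  | .loop _ P => P.modReg x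

/-- `P` may write to the array `a`. -/
def Prog.modArr (a : ℕ) : Prog → Bool
  | .skip => false
  | .set _ _ => false
  | .store b _ _ => b == a
  | .seq P Q => P.modArr a || Q.modArr a
  | .ite _ P Q => P.modArr a || Q.modArr a
  | .loop _ P => P.modArr a

/-- `s` and `s'` agree on everything that `P` does not write to. -/
structure Frame (P : Prog) (s s' : State) : Prop where
  reg : ∀ x, P.modReg x = false → s'.reg x = s.reg x
  arr : ∀ a, P.modArr a = false → s'.arr a = s.arr a

/-- What a program may write is read off its syntax, so the side conditions of later uses can be
settled by `decide`. -/
theorem Exec.frame {s s' : State} {t : ℕ} (h : Exec P s s' t) : Frame P s s' := by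
  induction h with
  | skip s => exact ⟨fun _ _ => rfl, fun _ _ => rfl⟩
  | set x e s =>
    refine ⟨fun y hy => ?_, fun _ _ => rfl⟩
    have : y ≠ x := by rintro rfl; simp [Prog.modReg] at hy
    simp [State.setReg, this]
  | store a i e s =>
    refine ⟨fun _ _ => rfl, fun y hy => ?_⟩
    have : y ≠ a := by rintro rfl; simp [Prog.modArr] at hy
    simp [State.setArr, this]
  | seq _ _ ih ih' =>
    refine ⟨fun y hy => ?_, fun y hy => ?_⟩
    · rw [Prog.modReg, Bool.or_eq_false_iff] at hy
      rw [ih'.reg y hy.2, ih.reg y hy.1]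
    · rw [Prog.modArr, Bool.or_eq_false_iff] at hy
      rw [ih'.arr y hy.2, ih.arr y hy.1]
  | ite_true _ _ ih =>
    refine ⟨fun y hy => ?_, fun y hy => ?_⟩
    · rw [Prog.modReg, Bool.or_eq_false_iff] at hy
      exact ih.reg y hy.1
    · rw [Prog.modArr, Bool.or_eq_false_iff] at hy
      exact ih.arr y hy.1
  | ite_false _ _ ih =>
    refine ⟨fun y hy => ?_, fun y hy => ?_⟩
    · rw [Prog.modReg, Bool.or_eq_false_iff] at hy
      exact ih.reg y hy.2
    · rw [Prog.modArr, Bool.or_eq_false_iff] at hy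
      exact ih.arr y hy.2
  | loop_done _ => exact ⟨fun _ _ => rfl, fun _ _ => rfl⟩
  | loop_step _ _ _ ih ih' =>
    refine ⟨fun y hy => ?_, fun y hy => ?_⟩
    · rw [ih'.reg y hy, ih.reg y hy]
    · rw [ih'.arr y hy, ih.arr y hy]

theorem Ev.frame (h : Ev B P s T Q) : Ev B P s T (fun s' => Frame P s s' ∧ Q s') := by
  intro hs
  obtain ⟨s', t, h1, h2, h3, h4⟩ := h hs
  exact ⟨s', t, h1, h2, h3, h1.frame, h4⟩

/-! ### Counting loops -/

/-- `for x := 0, …, (reg y) - 1 do P`. -/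
def forLoop (x y : ℕ) (P : Prog) : Prog :=
  .seq (.set x (.const 0)) (.loop (.bin .sub (.reg y) (.reg x))
    (.seq P (.set x (.bin .add (.reg x) (.const 1)))))

/-- Induction on the number `k` of remaining rounds, for all starting values `i` of the counter. A
round costs `T` units for the body and one each for the test and the increment; the last unit pays
for the failing test. -/
theorem Ev.forLoop_aux {x y N : ℕ} (hB : 0 < B) (hxy : y ≠ x) (hx : P.modReg x = false)
    (hy : P.modReg y = false) (I : ℕ → State → Prop)
    (step : ∀ i < N, ∀ s', Frame (forLoop x y P) s s' → s'.reg x = i → s'.reg y = N → I i s' →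
      Ev B P s' T (fun s'' => I (i + 1) (s''.setReg x (i + 1)))) :
    ∀ k i, i + k = N → ∀ s', Frame (forLoop x y P) s s' → s'.reg x = i → s'.reg y = N → I i s' →
      Ev B (.loop (.bin .sub (.reg y) (.reg x))
        (.seq P (.set x (.bin .add (.reg x) (.const 1))))) s' (k * (T + 2) + 1)
        (fun s'' => I N s'') := by
  intro k
  induction k with
  | zero =>
    intro i hi s' _ hsx hsy hI hg
    have he : (Expr.bin .sub (.reg y) (.reg x)).eval s' = 0 := by
      simp [Expr.eval, BinOp.eval, hsx, hsy]; omega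
    refine ⟨s', _, .loop_done he, ?_, hg, ?_⟩
    · simpa using add_one_le_unitCost hB (Expr.cost_le hB hg _) (by simp [Expr.factor, Expr.bits])
    · obtain rfl : i = N := by omega
      exact hI
  | succ k ih =>
    intro i hi s' hF hsx hsy hI hg
    have he : (Expr.bin .sub (.reg y) (.reg x)).eval s' ≠ 0 := by
      simp [Expr.eval, BinOp.eval, hsx, hsy]; omega
    obtain ⟨s₁, t₁, e₁, ht₁, hg₁, hI₁⟩ := step i (by omega) s' hF hsx hsy hI hg
    have f₁ := e₁.frame
    have hv : (Expr.bin .add (.reg x) (.const 1)).eval s₁ = i + 1 := by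
      simp [Expr.eval, BinOp.eval, f₁.reg x hx, hsx]
    -- The counter never exceeds the loop bound, which is itself stored in a cell.
    have hlt : i + 1 < 2 ^ B := by
      have := hg.reg y
      omega
    have e₂ := Exec.set x (.bin .add (.reg x) (.const 1)) s₁
    rw [hv] at e₂
    have hF₂ : Frame (forLoop x y P) s (s₁.setReg x (i + 1)) := by
      refine ⟨fun z hz => ?_, fun a ha => ?_⟩
      · have hz' := hz
        simp only [forLoop, Prog.modReg, Bool.or_eq_false_iff, beq_eq_false_iff_ne] at hz'
        have : z ≠ x := fun h => hz'.1 h.symm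
        simp only [State.setReg, Function.update_of_ne this]
        rw [f₁.reg z hz'.2.1, hF.reg z hz]
      · have ha' := ha
        simp only [forLoop, Prog.modArr, Bool.or_eq_false_iff] at ha'
        simp only [State.setReg]
        rw [f₁.arr a ha'.2.1, hF.arr a ha]
    obtain ⟨s₂, t₂, e₃, ht₂, hg₂, hI₂⟩ := ih (i + 1) (by omega) (s₁.setReg x (i + 1)) hF₂
      (by simp [State.setReg]) (by simp [State.setReg, hxy, f₁.reg y hy, hsy]) hI₁
      (hg₁.setReg hlt)
    refine ⟨s₂, _, .loop_step he (.seq e₁ e₂) e₃, ?_, hg₂, hI₂⟩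
    have c1 := add_one_le_unitCost hB
      (Expr.cost_le hB hg (.bin .sub (.reg y) (.reg x))) (by simp [Expr.factor, Expr.bits])
    have c2 := add_one_le_unitCost hB
      (Expr.cost_le hB hg₁ (.bin .add (.reg x) (.const 1))) (by simp [Expr.factor, Expr.bits])
    have : ((k + 1) * (T + 2) + 1) * unitCost B =
      T * unitCost B + unitCost B + unitCost B + (k * (T + 2) + 1) * unitCost B := by ring
    omega

theorem Ev.forLoop {x y : ℕ} (N : ℕ) (hN : s.reg y = N) (hB : 0 < B) (hxy : y ≠ x)
    (hx : P.modReg x = false) (hy : P.modReg y = false) (I : ℕ → State → Prop)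
    (init : I 0 (s.setReg x 0))
    (step : ∀ i < N, ∀ s', Frame (forLoop x y P) s s' → s'.reg x = i → s'.reg y = N → I i s' →
      Ev B P s' T (fun s'' => I (i + 1) (s''.setReg x (i + 1)))) :
    Ev B (forLoop x y P) s (N * (T + 2) + 2) (fun s' => Frame (RAM.forLoop x y P) s s' ∧ I N s') := by
  refine Ev.frame ?_
  refine Ev.le (T := 1 + (N * (T + 2) + 1))
    (Ev.seq (Ev.set hB (by simp [Expr.factor]) (fun _ => by simp [Expr.eval]) ?_)) (by omega)
  refine Ev.forLoop_aux hB hxy hx hy I step N 0 (by omega) _ ?_ (by simp [State.setReg, Expr.eval])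
    (by simp [State.setReg, hxy, hN]) init
  refine ⟨fun z hz => ?_, fun a ha => rfl⟩
  simp only [RAM.forLoop, Prog.modReg, Bool.or_eq_false_iff, beq_eq_false_iff_ne] at hz
  have : z ≠ x := fun h => hz.1 h.symm
  simp [State.setReg, this]

/-! ### Reading updated states -/

@[simp] theorem State.setReg_reg (s : State) (x v y : ℕ) :
    (s.setReg x v).reg y = if y = x then v else s.reg y := by
  simp [State.setReg, Function.update_apply]

@[simp] theorem State.setReg_arr (s : State) (x v : ℕ) : (s.setReg x v).arr = s.arr := rfl

@[simp] theorem State.setArr_reg (s : State) (a i v : ℕ) : (s.setArr a i v).reg = s.reg := rfl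

@[simp] theorem State.setArr_arr (s : State) (a i v b j : ℕ) :
    (s.setArr a i v).arr b j = if b = a ∧ j = i then v else s.arr b j := by
  simp only [State.setArr, Function.update_apply]
  split_ifs with h1 h2 h2 <;> simp_all

attribute [simp] Expr.eval BinOp.eval

end RAM

namespace Kemeny

open Finset RAM

/-! ### Words and their gains -/

section Words

variable (m : ℕ) (W : ℕ → ℕ → ℕ)

/-- The candidate `c` may be ranked next after the set `D`: no candidate outside `D` has to
precede it. -/
def Ok (D : Finset ℕ) (c : ℕ) : Prop :=
  c < m ∧ c ∉ D ∧ ∀ a < m, a ∉ D → a ≠ c → W c a ≠ 0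

/-- The weight of the agreements that are gained when `c` is ranked after the set `D`. -/
def gain (D : Finset ℕ) (c : ℕ) : ℕ := ∑ a ∈ D, W a c

/-- The word `l` leads from the set `D` to the set `D'` by admissible steps. -/
def Path : Finset ℕ → List ℕ → Finset ℕ → Prop
  | D, [], D' => D = D'
  | D, c :: l, D' => Ok m W D c ∧ Path (insert c D) l D'

/-- The total gain of the word `l`, ranked after the set `D`. -/
def gainSum : Finset ℕ → List ℕ → ℕ
  | _, [] => 0
  | D, c :: l => gain W D c + gainSum (insert c D) l

/-- The rankings that are admissible and have gain at least `thr`. -/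
def goodWords (thr : ℕ) : Set (List ℕ) :=
  {w | Path m W ∅ w (range m) ∧ thr ≤ gainSum W ∅ w}

variable {m W}

theorem path_append {l l' : List ℕ} {D D' : Finset ℕ} :
    Path m W D (l ++ l') D' ↔ ∃ E, Path m W D l E ∧ Path m W E l' D' := by
  induction l generalizing D with
  | nil => simp [Path]
  | cons c l ih =>
    simp only [List.cons_append, Path, ih, and_assoc]
    exact ⟨fun ⟨h, E, h'⟩ => ⟨E, h, h'⟩, fun ⟨E, h, h'⟩ => ⟨h, E, h'⟩⟩

theorem Path.eq {l : List ℕ} {D D' : Finset ℕ} (h : Path m W D l D') : D' = D ∪ l.toFinset := by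
  induction l generalizing D with
  | nil => simpa [Path] using h.symm
  | cons c l ih => rw [ih h.2]; ext; simp

theorem Path.nodup {l : List ℕ} {D D' : Finset ℕ} (h : Path m W D l D') :
    l.Nodup ∧ (∀ c ∈ l, c ∉ D) ∧ ∀ c ∈ l, c < m := by
  induction l generalizing D with
  | nil => simp
  | cons c l ih =>
    obtain ⟨h1, h2, h3⟩ := ih h.2
    refine ⟨List.nodup_cons.2 ⟨fun hc => h2 c hc (mem_insert_self _ _), h1⟩, ?_, ?_⟩
    · intro a ha
      rcases List.mem_cons.1 ha with rfl | ha
      · exact h.1.2.1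
      · exact fun had => h2 a ha (mem_insert_of_mem had)
    · intro a ha
      rcases List.mem_cons.1 ha with rfl | ha
      · exact h.1.1
      · exact h3 a ha

theorem Path.eq_toFinset {l : List ℕ} {D : Finset ℕ} (h : Path m W ∅ l D) : D = l.toFinset := by
  simpa using h.eq

theorem Path.subset {l : List ℕ} {D : Finset ℕ} (h : Path m W ∅ l D) : D ⊆ range m := by
  rw [h.eq_toFinset]
  intro c hc
  simpa using h.nodup.2.2 c (by simpa using hc)

theorem Path.card {l : List ℕ} {D : Finset ℕ} (h : Path m W ∅ l D) : #D = l.length := by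
  rw [h.eq_toFinset, List.toFinset_card_of_nodup h.nodup.1]

/-- A step is admissible only when no unanimous predecessor of the new candidate is missing, so sets
reached from `∅` are closed under unanimous predecessors. -/
theorem Path.mem_of_unanimous {l : List ℕ} {D : Finset ℕ} (h : Path m W ∅ l D) {a c : ℕ}
    (hc : c ∈ D) (ha : a < m) (hac : a ≠ c) (hW : W c a = 0) : a ∈ D := by
  -- The induction needs an arbitrary closed starting set in place of `∅`.
  have key : ∀ (l : List ℕ) (E : Finset ℕ), (∀ c ∈ E, ∀ a < m, a ≠ c → W c a = 0 → a ∈ E) →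
      Path m W E l D → ∀ c ∈ D, ∀ a < m, a ≠ c → W c a = 0 → a ∈ D := by
    intro l
    induction l with
    | nil =>
      intro E hE h
      rw [← show E = D from h]
      exact hE
    | cons d l ih =>
      intro E hE h
      refine ih (insert d E) ?_ h.2
      intro c hc a ha hac hW
      rcases mem_insert.1 hc with rfl | hc
      · by_contra had
        rw [mem_insert, not_or] at had
        exact h.1.2.2 a ha had.2 hac hW
      · exact mem_insert_of_mem (hE c hc a ha hac hW)
  exact key l ∅ (by simp) h c hc a ha hac hW

theorem gainSum_append {l l' : List ℕ} {D : Finset ℕ} :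
    gainSum W D (l ++ l') = gainSum W D l + gainSum W (D ∪ l.toFinset) l' := by
  induction l generalizing D with
  | nil => simp [gainSum]
  | cons c l ih =>
    have : insert c D ∪ l.toFinset = D ∪ (c :: l).toFinset := by ext; simp
    simp only [List.cons_append, gainSum, ih, this]
    ring

theorem path_concat {l : List ℕ} {D : Finset ℕ} {c : ℕ} (h : Path m W ∅ l D) (hc : Ok m W D c) :
    Path m W ∅ (l ++ [c]) (insert c D) ∧ gainSum W ∅ (l ++ [c]) = gainSum W ∅ l + gain W D c := by
  refine ⟨path_append.2 ⟨D, h, hc, rfl⟩, ?_⟩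
  rw [gainSum_append, empty_union, ← h.eq_toFinset]
  simp [gainSum]

theorem gainSum_le {n : ℕ} (hW : ∀ a b, W a b ≤ n) {l : List ℕ} {D : Finset ℕ}
    (h : Path m W ∅ l D) : gainSum W ∅ l ≤ n * m * m := by
  have key : ∀ (l : List ℕ) (E : Finset ℕ), E ⊆ range m → (∀ c ∈ l, c < m) →
      gainSum W E l ≤ l.length * (m * n) := by
    intro l
    induction l with
    | nil => simp [gainSum]
    | cons c l ih =>
      intro E hE hl
      have h1 : gain W E c ≤ m * n := by
        refine (sum_le_card_nsmul E _ n fun a _ => hW a c).trans ?_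
        have := card_le_card hE
        rw [card_range] at this
        exact Nat.mul_le_mul_right _ this
      have h2 := ih (insert c E) (insert_subset (mem_range.2 (hl c (by simp))) hE)
        fun a ha => hl a (by simp [ha])
      simp only [gainSum, List.length_cons]
      linarith
  refine (key l ∅ (by simp) h.nodup.2.2).trans ?_
  have h1 : l.length ≤ m := by
    rw [← h.card]
    simpa using card_le_card h.subset
  calc l.length * (m * n) ≤ m * (m * n) := Nat.mul_le_mul_right _ h1
    _ = n * m * m := by ring

end Words

/-! ### Sets of numbers as bit masks -/

/-- The number whose binary digits are the indicator of `D`. -/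
def mask (D : Finset ℕ) : ℕ := ∑ i ∈ D, 2 ^ i

theorem mask_insert {D : Finset ℕ} {c : ℕ} (h : c ∉ D) : mask (insert c D) = mask D + 2 ^ c := by
  rw [mask, sum_insert h, add_comm, mask]

theorem mask_erase {D : Finset ℕ} {c : ℕ} (h : c ∈ D) : mask (D.erase c) = mask D - 2 ^ c := by
  have := mask_insert (notMem_erase c D)
  rw [insert_erase h] at this
  omega

theorem mask_injective : Function.Injective mask := fun D E h => by
  have := congrArg (fun n => n.bitIndices.toFinset) h
  simpa [mask] using this

theorem mask_range (m : ℕ) : mask (range m) = 2 ^ m - 1 := by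
  have := Nat.geomSum_eq (le_refl 2) m
  simpa [mask] using this

theorem mask_lt {D : Finset ℕ} {m : ℕ} (h : D ⊆ range m) : mask D < 2 ^ m := by
  have h1 : mask D ≤ mask (range m) := sum_le_sum_of_subset h
  rw [mask_range] at h1
  have := Nat.two_pow_pos m
  omega

/-- The machine has neither a remainder nor a bit test; `x - 2 * (x / 2)` is the parity of `x`. -/
theorem mask_bit (D : Finset ℕ) (a : ℕ) :
    mask D / 2 ^ a - 2 * (mask D / 2 ^ a / 2) = if a ∈ D then 1 else 0 := by
  have h : (mask D).testBit a = decide (a ∈ D) := by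
    have : (mask D).bitIndices.toFinset = D := by simp [mask]
    rw [Bool.eq_iff_iff, decide_eq_true_iff, ← Nat.mem_bitIndices, ← List.mem_toFinset, this]
  rw [Nat.testBit_eq_decide_div_mod_eq, decide_eq_decide] at h
  split_ifs with h1
  · have := h.2 h1
    omega
  · have := mt h.1 h1
    omega

/-! ### The table of the optimal gains -/

section Table

variable (m : ℕ) (W : ℕ → ℕ → ℕ)

/-- The list `lst` contains the sets with non-zero entries in `tab`, and these entries are gains,
increased by one. -/
structure TabInv (lst : List (Finset ℕ)) (tab : Finset ℕ → ℕ) : Prop where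
  sound : ∀ D, tab D ≠ 0 → ∃ l, Path m W ∅ l D ∧ tab D = gainSum W ∅ l + 1
  nodup : lst.Nodup
  mem_iff : ∀ D, D ∈ lst ↔ tab D ≠ 0

/-- The table is optimal on the sets of at most `k` elements. -/
def CompleteUpTo (k : ℕ) (tab : Finset ℕ → ℕ) : Prop :=
  ∀ D l, Path m W ∅ l D → #D ≤ k → gainSum W ∅ l + 1 ≤ tab D

/-- All ways to put `c` after `D` are accounted for in the table. -/
def Relaxed (tab : Finset ℕ → ℕ) (D : Finset ℕ) (c : ℕ) : Prop :=
  ∀ l, Path m W ∅ l D → Ok m W D c → gainSum W ∅ l + gain W D c + 1 ≤ tab (insert c D)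

open Classical in
/-- The table after the entry of `insert c D` has been updated. -/
noncomputable def relaxTab (tab : Finset ℕ → ℕ) (D : Finset ℕ) (c : ℕ) : Finset ℕ → ℕ :=
  if Ok m W D c then
    Function.update tab (insert c D) (max (tab (insert c D)) (tab D + gain W D c))
  else tab

open Classical in
/-- The list after the entry of `insert c D` has been updated. -/
noncomputable def relaxList (lst : List (Finset ℕ)) (tab : Finset ℕ → ℕ) (D : Finset ℕ) (c : ℕ) :
    List (Finset ℕ) :=
  if Ok m W D c ∧ tab (insert c D) = 0 then lst ++ [insert c D] else lst

/-- The state after the first `j` sets of the list `lst₀` and the first `c` candidates for the next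
one have been processed in the round `k`. -/
structure RoundInv (k : ℕ) (lst₀ : List (Finset ℕ)) (j c : ℕ) (lst : List (Finset ℕ))
    (tab : Finset ℕ → ℕ) : Prop extends TabInv m W lst tab where
  pre : lst₀ <+: lst
  complete : CompleteUpTo m W k tab
  complete_mem : ∀ D l, Path m W ∅ l D → #D ≤ k → D ∈ lst₀
  done : ∀ j' (h : j' < lst₀.length), #lst₀[j'] ≤ k → ∀ d < m, j' < j ∨ j' = j ∧ d < c →
    Relaxed m W tab lst₀[j'] d

variable {m W}

/-- Entries never decrease, so lower bounds established earlier in a round survive all later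
updates. -/
theorem le_relaxTab (tab : Finset ℕ → ℕ) (D : Finset ℕ) (c : ℕ) (E : Finset ℕ) :
    tab E ≤ relaxTab m W tab D c E := by
  unfold relaxTab
  split_ifs with h
  · rw [Function.update_apply]
    split_ifs with h1
    · rw [h1]; exact le_max_left _ _
    · exact le_rfl
  · exact le_rfl

/-- A word realising the entry of `D`, with `c` appended, realises the proposed new entry; the shift
by one is passed on. A set joins the list exactly when its entry turns non-zero. -/
theorem TabInv.relax {lst : List (Finset ℕ)} {tab : Finset ℕ → ℕ} (h : TabInv m W lst tab)
    {D : Finset ℕ} (hD : D ∈ lst) (c : ℕ) :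
    TabInv m W (relaxList m W lst tab D c) (relaxTab m W tab D c) := by
  by_cases hok : Ok m W D c
  swap
  · simpa [relaxList, relaxTab, hok] using h
  have hD' := (h.mem_iff D).1 hD
  obtain ⟨l, hl, hv⟩ := h.sound D hD'
  refine ⟨fun E hE => ?_, ?_, fun E => ?_⟩
  · simp only [relaxTab, hok, if_true, Function.update_apply] at hE ⊢
    split_ifs at hE ⊢ with h1
    · subst h1
      rcases le_total (tab D + gain W D c) (tab (insert c D)) with h2 | h2
      · rw [max_eq_left h2] at hE ⊢
        exact h.sound _ hE
      · rw [max_eq_right h2]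
        obtain ⟨a, b⟩ := path_concat hl hok
        exact ⟨_, a, by omega⟩
    · exact h.sound E hE
  · unfold relaxList
    split_ifs with h1
    · rw [List.nodup_append]
      refine ⟨h.nodup, by simp, ?_⟩
      intro a ha b hb hab
      rw [List.mem_singleton] at hb
      subst hb hab
      exact (h.mem_iff _).1 ha h1.2
    · exact h.nodup
  · simp only [relaxTab, relaxList, hok, if_true, true_and, Function.update_apply]
    by_cases h1 : E = insert c D
    · subst h1
      rw [if_pos rfl]
      refine ⟨fun _ => by omega, fun _ => ?_⟩
      split_ifs with h2
      · simp
      · exact (h.mem_iff _).2 h2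
    · rw [if_neg h1, ← h.mem_iff]
      split_ifs <;> simp [h1]

/-- The pair just processed becomes `Relaxed` because the entry of a set with at most `k` elements
is already optimal in round `k`. -/
theorem RoundInv.relax {k j c : ℕ} {lst₀ lst : List (Finset ℕ)} {tab : Finset ℕ → ℕ}
    (h : RoundInv m W k lst₀ j c lst tab) (hj : j < lst₀.length) :
    RoundInv m W k lst₀ j (c + 1) (relaxList m W lst tab lst₀[j] c)
      (relaxTab m W tab lst₀[j] c) where
  toTabInv := h.toTabInv.relax (h.pre.subset (List.getElem_mem hj)) c
  pre := by
    unfold relaxList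
    split_ifs
    · exact h.pre.trans (List.prefix_append _ _)
    · exact h.pre
  complete D l hl hk := (h.complete D l hl hk).trans (le_relaxTab _ _ _ _)
  complete_mem := h.complete_mem
  done j' hj' hk d hd hd' := by
    by_cases hjd : j' = j ∧ d = c
    · obtain ⟨rfl, rfl⟩ := hjd
      intro l hl hok
      have := h.complete _ l hl hk
      simp only [relaxTab, hok, if_true, Function.update_self]
      omega
    · intro l hl hok
      exact (h.done j' hj' hk d hd (by omega) l hl hok).trans (le_relaxTab _ _ _ _)

theorem RoundInv.next {k j : ℕ} {lst₀ lst : List (Finset ℕ)} {tab : Finset ℕ → ℕ}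
    (h : RoundInv m W k lst₀ j m lst tab) : RoundInv m W k lst₀ (j + 1) 0 lst tab :=
  { h with done := fun j' hj' hk d hd hd' => h.done j' hj' hk d hd (by omega) }

theorem RoundInv.start {k : ℕ} {lst : List (Finset ℕ)} {tab : Finset ℕ → ℕ}
    (h : TabInv m W lst tab) (hk : CompleteUpTo m W k tab) :
    RoundInv m W k lst 0 0 lst tab where
  toTabInv := h
  pre := List.prefix_rfl
  complete := hk
  complete_mem D l hl hD := (h.mem_iff D).2 (by have := hk D l hl hD; omega)
  done := by omega

/-- A best word for a set of `k + 1` elements splits into a prefix and a last letter. The set of the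
prefix has `k` elements, so it was on the list when the round began, and the round relaxed it with
that letter. -/
theorem RoundInv.finish {k : ℕ} {lst₀ lst : List (Finset ℕ)} {tab : Finset ℕ → ℕ}
    (h : RoundInv m W k lst₀ lst₀.length 0 lst tab) : CompleteUpTo m W (k + 1) tab := by
  intro D l hl hD
  rcases Nat.lt_or_ge k #D with hk | hk
  · have hne : l ≠ [] := by
      rintro rfl
      simp [hl.card] at hk
    obtain ⟨u, c, rfl⟩ : ∃ u c, l = u ++ [c] := ⟨_, _, (List.dropLast_concat_getLast hne).symm⟩
    obtain ⟨E, hu, hok, hE⟩ := path_append.1 hl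
    have hE : insert c E = D := hE
    have hcard : #E ≤ k := by
      have := card_insert_of_notMem hok.2.1
      rw [hE] at this
      omega
    obtain ⟨j, hj, rfl⟩ := List.getElem_of_mem (h.complete_mem E u hu hcard)
    have := h.done j hj hcard c hok.1 (Or.inl hj) u hu hok
    rw [hE] at this
    rw [(path_concat hu hok).2]
    omega
  · exact h.complete D l hl hk

/-- The table at the beginning. -/
theorem TabInv.init : TabInv m W [∅] (fun D => if D = ∅ then 1 else 0) ∧
    CompleteUpTo m W 0 (fun D => if D = ∅ then 1 else 0) := by
  refine ⟨⟨fun D hD => ?_, by simp, by simp⟩, fun D l hl hD => ?_⟩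
  · have : D = ∅ := by by_contra h; simp [h] at hD
    subst this
    exact ⟨[], rfl, by simp [gainSum]⟩
  · obtain rfl : D = ∅ := by simpa using hD
    have : l = [] := by simpa using hl.card.symm
    simp [this, gainSum]

theorem TabInv.reachable {lst : List (Finset ℕ)} {tab : Finset ℕ → ℕ} (h : TabInv m W lst tab)
    {D : Finset ℕ} (hD : D ∈ lst) : ∃ l, Path m W ∅ l D := by
  obtain ⟨l, hl, -⟩ := h.sound D ((h.mem_iff D).1 hD)
  exact ⟨l, hl⟩

/-- The test by which suffixes of good words are extended. -/
theorem cons_suffix_iff {lst : List (Finset ℕ)} {tab : Finset ℕ → ℕ} (h : TabInv m W lst tab)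
    (hc : CompleteUpTo m W m tab) {thr : ℕ} {l : List ℕ}
    (hl : ∃ u, u ++ l ∈ goodWords m W thr) (c : ℕ) :
    (∃ u, u ++ c :: l ∈ goodWords m W thr) ↔ c ∈ range m \ l.toFinset ∧
      tab ((range m \ l.toFinset).erase c) ≠ 0 ∧
      thr < tab ((range m \ l.toFinset).erase c) + gain W ((range m \ l.toFinset).erase c) c +
        gainSum W (range m \ l.toFinset) l := by
  obtain ⟨u₀, hu₀, -⟩ := hl
  obtain ⟨D₀, hD₀, hD₀l⟩ := path_append.1 hu₀
  -- The set from which a suffix leads to all candidates is the complement of the suffix.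
  have key : ∀ E, Path m W E l (range m) → E = range m \ l.toFinset := by
    intro E hE
    have h1 := hE.eq
    have h2 := hE.nodup.2.1
    ext a
    rw [h1]
    simp only [mem_sdiff, mem_union, List.mem_toFinset]
    have := h2 a
    tauto
  obtain rfl := key D₀ hD₀l
  set D := range m \ l.toFinset with hD
  constructor
  · rintro ⟨u, hu, ht⟩
    obtain ⟨E, hE, hok, hEl⟩ := path_append.1 hu
    have hED : insert c E = D := key _ hEl
    have hE' : D.erase c = E := by rw [← hED, erase_insert hok.2.1]
    have hcD : c ∈ D := by rw [← hED]; exact mem_insert_self _ _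
    -- Entries are gains plus one, which accounts for the strict inequality in the test.
    have hcomp := hc E u hE (by simpa using card_le_card hE.subset)
    rw [hE']
    refine ⟨hcD, by omega, ?_⟩
    rw [gainSum_append, empty_union, ← hE.eq_toFinset, gainSum, hED] at ht
    omega
  · rintro ⟨hcD, h1, h2⟩
    obtain ⟨u, hu, hv⟩ := h.sound _ h1
    -- `D` is reachable and contains `c`, hence contains all unanimous predecessors of `c`; they
    -- survive the removal of `c`.
    have hok : Ok m W (D.erase c) c := by
      refine ⟨mem_range.1 (mem_sdiff.1 hcD).1, notMem_erase _ _, ?_⟩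
      intro a ha haD hac hW
      exact haD (mem_erase.2 ⟨hac, hD₀.mem_of_unanimous hcD ha hac hW⟩)
    refine ⟨u, path_append.2 ⟨_, hu, hok, by rwa [insert_erase hcD]⟩, ?_⟩
    rw [gainSum_append, empty_union, ← hu.eq_toFinset, gainSum, insert_erase hcD]
    omega

end Table

/-! ### Enumerating words from their suffixes -/

section Enumeration

variable (K : Set (List ℕ)) (m r : ℕ)

open Classical in
/-- The extension of the suffix `l` by the letter `c`, if it is a suffix of a word in `K`. -/
noncomputable def child (l : List ℕ) (c : ℕ) : List (List ℕ) :=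
  if ∃ u, u ++ c :: l ∈ K then [c :: l] else []

/-- The extensions of the suffixes in `E` by one letter, at most `r` of them. -/
noncomputable def nextLevel (E : List (List ℕ)) : List (List ℕ) :=
  (E.flatMap fun l => (List.range m).flatMap fun c => child K l c).take r

/-- `E` lists suffixes of words in `K` that lack the first `k` letters: `r` or all of them. -/
structure LevelInv (k : ℕ) (E : List (List ℕ)) : Prop where
  nodup : E.Nodup
  suffix : ∀ l ∈ E, ∃ u, u.length = k ∧ u ++ l ∈ K
  length_le : E.length ≤ r
  full : E.length = r ∨ ∀ u l, u.length = k → u ++ l ∈ K → l ∈ E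

variable {K m r}

theorem mem_child {l l' : List ℕ} {c : ℕ} :
    l' ∈ child K l c ↔ l' = c :: l ∧ ∃ u, u ++ l' ∈ K := by
  unfold child
  split_ifs with h
  · simp only [List.mem_singleton]
    exact ⟨fun e => ⟨e, e ▸ h⟩, fun e => e.1⟩
  · simp only [List.not_mem_nil, false_iff]
    rintro ⟨rfl, h'⟩
    exact h h'

theorem nodup_children (l : List ℕ) :
    ((List.range m).flatMap fun c => child K l c).Nodup := by
  rw [List.nodup_flatMap]
  refine ⟨fun c _ => by unfold child; split_ifs <;> simp, ?_⟩
  refine List.Pairwise.imp (R := fun a b => a ≠ b) ?_ (List.nodup_range)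
  intro a b hab l₁ h₁ h₂
  have e := (mem_child.1 h₁).1.symm.trans (mem_child.1 h₂).1
  simp only [List.cons.injEq, and_true] at e
  exact hab e

/-- Each suffix has a child, so a level with `r` suffixes is followed by one with `r` suffixes. A
smaller level is complete, and then the next one is complete too unless it is cut at `r`. Children
of different suffixes, or by different letters, differ, so no repetition arises. -/
theorem LevelInv.next (hK : ∀ w ∈ K, w.length = m ∧ ∀ c ∈ w, c < m) {k : ℕ} (hk : k < m) {E : List (List ℕ)}
    (h : LevelInv K r (k + 1) E) : LevelInv K r k (nextLevel K m r E) := by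
  have hmem : ∀ l', l' ∈ (E.flatMap fun l => (List.range m).flatMap fun c => child K l c) ↔
      ∃ l ∈ E, ∃ c < m, l' = c :: l ∧ ∃ u, u ++ l' ∈ K := by
    intro l'
    simp only [List.mem_flatMap, List.mem_range, mem_child]
  have hlen : E.length ≤
      (E.flatMap fun l => (List.range m).flatMap fun c => child K l c).length := by
    rw [List.length_flatMap]
    have : E.length = (E.map fun _ => 1).sum := by simp
    rw [this]
    refine List.sum_le_sum fun l hl => ?_
    -- The missing prefix has `k + 1` letters; its last letter provides a child.
    obtain ⟨u, hu, huK⟩ := h.suffix l hl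
    obtain ⟨v, c, rfl⟩ : ∃ v c, u = v ++ [c] :=
      ⟨_, _, (List.dropLast_concat_getLast (l := u) (by rintro rfl; simp at hu)).symm⟩
    rw [List.append_assoc, List.singleton_append] at huK
    refine List.length_pos_of_mem (a := c :: l) ?_
    simp only [List.mem_flatMap, List.mem_range, mem_child]
    exact ⟨c, (hK _ huK).2 c (by simp), rfl, v, huK⟩
  refine ⟨?_, ?_, ?_, ?_⟩
  · refine List.Nodup.sublist (List.take_sublist _ _) ?_
    rw [List.nodup_flatMap]
    refine ⟨fun l _ => nodup_children l, ?_⟩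
    refine List.Pairwise.imp (R := fun a b => a ≠ b) ?_ h.nodup
    intro a b hab l₁ h₁ h₂
    simp only [List.mem_flatMap, mem_child] at h₁ h₂
    obtain ⟨c, _, rfl, _⟩ := h₁
    obtain ⟨d, _, e, _⟩ := h₂
    simp only [List.cons.injEq] at e
    exact hab e.2
  · intro l' hl'
    obtain ⟨l, hl, c, hc, rfl, u, hu⟩ := (hmem l').1 (List.mem_of_mem_take hl')
    obtain ⟨v, hv, hvK⟩ := h.suffix l hl
    have h1 := (hK _ hu).1
    have h2 := (hK _ hvK).1
    simp only [List.length_append, List.length_cons] at h1 h2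
    exact ⟨u, by omega, hu⟩
  · simp [nextLevel]
  · rcases h.full with h1 | h1
    · left
      rw [nextLevel, List.length_take]
      omega
    · rcases le_or_gt r
        (E.flatMap fun l => (List.range m).flatMap fun c => child K l c).length with h2 | h2
      · left
        rw [nextLevel, List.length_take]
        omega
      · right
        intro u l' hu hK'
        rw [nextLevel, List.take_of_length_le h2.le, hmem]
        have h3 := hK _ hK'
        cases l' with
        | nil => simp at h3; omega
        | cons c l =>
          exact ⟨l, h1 (u ++ [c]) l (by simp [hu]) (by simpa using hK'), c, h3.2 c (by simp), rfl,
            u, hK'⟩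

theorem LevelInv.init (hr : 0 < r) (hne : ∃ w ∈ K, w.length = m)
    (hK : ∀ w ∈ K, w.length = m) : LevelInv K r m [[]] := by
  obtain ⟨w, hw, hl⟩ := hne
  refine ⟨by simp, by simpa using ⟨w, hl, hw⟩, hr, Or.inr fun u l hu hul => ?_⟩
  have := hK _ hul
  rw [List.length_append, hu] at this
  simpa using this

/-- At level 0 nothing is missing, so the suffixes are words of `K`. -/
theorem LevelInv.length_eq (hfin : K.Finite) {E : List (List ℕ)} (h : LevelInv K r 0 E) :
    (∀ l ∈ E, l ∈ K) ∧ E.length = min r K.ncard := by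
  have hsub : ∀ l ∈ E, l ∈ K := fun l hl => by
    obtain ⟨u, hu, huK⟩ := h.suffix l hl
    rw [List.length_eq_zero_iff.1 hu] at huK
    exact huK
  have hcard : (E.toFinset : Set (List ℕ)).ncard = E.length := by
    rw [Set.ncard_coe_finset, List.toFinset_card_of_nodup h.nodup]
  have hle : E.length ≤ K.ncard := by
    rw [← hcard]
    exact Set.ncard_le_ncard (fun l hl => hsub l (by simpa using hl)) hfin
  refine ⟨hsub, ?_⟩
  rcases h.full with h1 | h1
  · omega
  · have : K.ncard ≤ E.length := by
      rw [← hcard]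
      exact Set.ncard_le_ncard (fun l hl => by simpa using h1 [] l rfl hl) (Finset.finite_toSet _)
    have := h.length_le
    omega

end Enumeration

/-! ### The program

Registers: `0` number of candidates, `1` number of votes, `2` number of rankings asked for,
`3` threshold for the gain; `20`, `21` a set and a candidate that is ranked next, `22`, `23` the
gain and a flag for inadmissible steps; the others are local.

Arrays: `0` input, `1` output, `2` the pairwise majorities, `3` the powers of two, `4` the table of
the optimal gains, `5` the list of the reachable sets, `6`, `7`, `8` the sets, gains and codes of the
suffixes. -/

local infixl:65 " +ₑ " => Expr.bin BinOp.add
local infixl:65 " -ₑ " => Expr.bin BinOp.sub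
local infixl:70 " *ₑ " => Expr.bin BinOp.mul
local infixl:70 " /ₑ " => Expr.bin BinOp.div
local infixr:50 " ;; " => Prog.seq

/-- The last binary digit. -/
def lowBit (e : Expr) : Expr := e -ₑ .const 2 *ₑ (e /ₑ .const 2)

/-- The bit of the set in register `x` at the position in register `y`. -/
def bitOf (x y : ℕ) : Expr := lowBit (.reg x /ₑ .load 3 (.reg y))

/-- The gain of ranking the candidate in register `21` after the set in register `20`, and whether
this is admissible. -/
def rankNext : Prog :=
  .set 22 (.const 0) ;; .set 23 (.const 0) ;;
  forLoop 24 0 (.ite (bitOf 20 24)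
    (.set 22 (.reg 22 +ₑ .load 2 (.reg 24 *ₑ .reg 0 +ₑ .reg 21)))
    (.ite ((.reg 24 -ₑ .reg 21) +ₑ (.reg 21 -ₑ .reg 24))
      (.ite (.load 2 (.reg 21 *ₑ .reg 0 +ₑ .reg 24)) .skip (.set 23 (.const 1))) .skip))

/-- The powers of two. -/
def powersOfTwo : Prog :=
  .store 3 (.const 0) (.const 1) ;;
  forLoop 10 0 (.store 3 (.reg 10 +ₑ .const 1) (.const 2 *ₑ .load 3 (.reg 10)))

/-- Update the table by ranking candidate `21` after the set `20`. -/
def relaxProg : Prog :=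
  rankNext ;; .ite (bitOf 20 21) .skip (.ite (.reg 23) .skip
    (.set 34 (.reg 20 +ₑ .load 3 (.reg 21)) ;; .set 35 (.load 4 (.reg 20) +ₑ .reg 22) ;;
      .ite (.load 4 (.reg 34)) .skip (.store 5 (.reg 30) (.reg 34) ;;
        .set 30 (.reg 30 +ₑ .const 1)) ;;
      .ite (.reg 35 -ₑ .load 4 (.reg 34)) (.store 4 (.reg 34) (.reg 35)) .skip))

/-- The table of the optimal gains. -/
def tableProg : Prog :=
  .store 4 (.const 0) (.const 1) ;; .set 30 (.const 1) ;; .store 5 (.const 0) (.const 0) ;;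
  forLoop 31 0 (.set 32 (.reg 30) ;;
    forLoop 33 32 (.set 20 (.load 5 (.reg 33)) ;; forLoop 21 0 relaxProg))

/-- The context of the inner programs: the pairwise majorities `W` of `m` candidates and the powers
of two are available. -/
structure Ctx (m : ℕ) (W : ℕ → ℕ → ℕ) (s : State) : Prop where
  reg : s.reg 0 = m
  maj : ∀ a < m, ∀ b < m, s.arr 2 (a * m + b) = W a b
  pow : ∀ j ≤ m, s.arr 3 j = 2 ^ j

theorem Ctx.congr {m : ℕ} {W : ℕ → ℕ → ℕ} {s s' : State} (h : Ctx m W s)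
    (h0 : s'.reg 0 = s.reg 0) (h2 : s'.arr 2 = s.arr 2) (h3 : s'.arr 3 = s.arr 3) :
    Ctx m W s' := by
  constructor
  · rw [h0, h.reg]
  · rw [h2]; exact h.maj
  · rw [h3]; exact h.pow

theorem Ctx.frame {m : ℕ} {W : ℕ → ℕ → ℕ} {s s' : State} {P : Prog} (h : Ctx m W s)
    (F : Frame P s s') (h0 : P.modReg 0 = false) (h2 : P.modArr 2 = false)
    (h3 : P.modArr 3 = false) : Ctx m W s' :=
  h.congr (F.reg 0 h0) (F.arr 2 h2) (F.arr 3 h3)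

theorem eval_bitOf {m : ℕ} {W : ℕ → ℕ → ℕ} {s : State} (h : Ctx m W s) {x y : ℕ} {D : Finset ℕ}
    (hx : s.reg x = mask D) (hy : s.reg y ≤ m) :
    (bitOf x y).eval s = if s.reg y ∈ D then 1 else 0 := by
  simp only [bitOf, lowBit, Expr.eval, BinOp.eval, hx, h.pow _ hy]
  exact mask_bit D _

/-- Numbers that occur in the program have at most `B` bits. -/
structure Bounds (B m n r : ℕ) : Prop where
  pos : 0 < B
  pow : 2 ^ m * 2 < 2 ^ B
  tot : n * m * m + 1 < 2 ^ B
  list : (m + 1) * (r + 1) < 2 ^ B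
  code : m ^ m * 2 < 2 ^ B

/-! ### Correctness and time of the programs for the table -/

theorem ev_powersOfTwo {B m n r : ℕ} (hb : Bounds B m n r) {s : State} (h0 : s.reg 0 = m) :
    Ev B powersOfTwo s (4 * (m + 1)) (fun s' => ∀ j ≤ m, s'.arr 3 j = 2 ^ j) := by
  refine Ev.le (Ev.storeSeq (T := m * (1 + 2) + 2) hb.pos (by decide) (fun _ => ?_) ?_) ?_
  · have := hb.tot
    simp only [Expr.eval]; omega
  · refine (Ev.forLoop m ?_ hb.pos (by decide) (by decide) (by decide)
      (fun i s' => ∀ j ≤ i, s'.arr 3 j = 2 ^ j) ?_ ?_).mono le_rfl fun _ h => h.2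
    · simpa using h0
    · intro j hj
      obtain rfl : j = 0 := by omega
      simp [Expr.eval]
    · intro i hi s' _ h10 h0' hI
      refine Ev.store hb.pos (by decide) (fun _ => ?_) ?_
      · simp only [Expr.eval, BinOp.eval, h10, hI i le_rfl]
        have h1 : 2 ^ i ≤ 2 ^ m := Nat.pow_le_pow_right (by norm_num) hi.le
        have := hb.pow
        omega
      · intro j hj
        simp only [Expr.eval, BinOp.eval, h10, State.setReg_arr, State.setArr_arr, true_and, hI i le_rfl]
        split_ifs with h1
        · rw [h1]; ring
        · exact hI j (by omega)
  · omega

theorem ev_rankNext {B m n r : ℕ} (hb : Bounds B m n r) {W : ℕ → ℕ → ℕ} (hW : ∀ a b, W a b ≤ n)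
    {s : State} (hs : Ctx m W s) {D : Finset ℕ} (hD : D ⊆ range m) (h20 : s.reg 20 = mask D)
    {c : ℕ} (hc : c < m) (h21 : s.reg 21 = c) :
    Ev B rankNext s (9 * (m + 1)) (fun s' => s'.reg 22 = gain W D c ∧
      (s'.reg 23 = 0 ↔ ∀ a < m, a ∉ D → a ≠ c → W c a ≠ 0)) := by
  have h1B : 1 < 2 ^ B := by have := hb.tot; omega
  refine Ev.le (Ev.setSeq hb.pos (by decide) (fun _ => by simp [Expr.eval])
    (Ev.setSeq (T := m * (7 + 2) + 2) hb.pos (by decide) (fun _ => by simp [Expr.eval]) ?_)) ?_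
  · refine (Ev.forLoop m ?_ hb.pos (by decide) (by decide) (by decide)
      (fun i s' => s'.reg 22 = gain W (D ∩ range i) c ∧
        (s'.reg 23 = 0 ↔ ∀ a < i, a ∉ D → a ≠ c → W c a ≠ 0)) ?_ ?_).mono le_rfl ?_
    · simpa using hs.reg
    · simp [gain, Expr.eval]
    · intro i hi s' F h24 h0 ⟨h22, h23⟩
      have f20 : s'.reg 20 = mask D := by rw [F.reg 20 (by decide)]; simpa using h20
      have f21 : s'.reg 21 = c := by rw [F.reg 21 (by decide)]; simpa using h21
      have hs' : Ctx m W s' := hs.congr (by rw [F.reg 0 (by decide)]; simp)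
        (by rw [F.arr 2 (by decide)]; simp) (by rw [F.arr 3 (by decide)]; simp)
      have hbit := eval_bitOf hs' f20 (y := 24) (by omega)
      rw [h24] at hbit
      have hins : i ∈ D → gain W (D ∩ range (i + 1)) c = gain W (D ∩ range i) c + W i c := by
        intro h
        have : D ∩ range (i + 1) = insert i (D ∩ range i) := by
          ext a; simp only [mem_inter, mem_range, mem_insert]
          constructor
          · rintro ⟨h1, h2⟩
            by_cases e : a = i
            · exact Or.inl e
            · exact Or.inr ⟨h1, by omega⟩
          · rintro (rfl | ⟨h1, h2⟩)
            · exact ⟨h, by omega⟩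
            · exact ⟨h1, by omega⟩
        rw [gain, this, sum_insert (by simp), add_comm, gain]
      have hnot : i ∉ D → D ∩ range (i + 1) = D ∩ range i := by
        intro h
        ext a; simp only [mem_inter, mem_range, and_congr_right_iff]
        intro ha
        have : a ≠ i := by rintro rfl; exact h ha
        omega
      refine Ev.le (Ev.ite (T := 1) (T' := 5) hb.pos (by decide) (fun hne => ?_) (fun he => ?_))
        (by omega)
      · have hiD : i ∈ D := by by_contra h; simp [hbit, h] at hne
        have hcell := hs'.maj i hi c hc
        refine Ev.set hb.pos (by decide) (fun _ => ?_) ?_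
        · simp only [Expr.eval, BinOp.eval, h22, h24, h0, f21, hcell]
          rw [← hins hiD]
          have h1 : gain W (D ∩ range (i + 1)) c ≤ #(D ∩ range (i + 1)) • n :=
            sum_le_card_nsmul _ _ _ fun a _ => hW a c
          have h2 : #(D ∩ range (i + 1)) ≤ m := by
            have := card_le_card (inter_subset_left (s₁ := D) (s₂ := range (i + 1)) |>.trans hD)
            simpa using this
          have h3 : #(D ∩ range (i + 1)) • n ≤ m * n := Nat.mul_le_mul_right _ h2
          have h4 : m * n ≤ n * m * m := by
            rw [mul_comm]
            exact Nat.le_mul_of_pos_right _ (by omega)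
          have := hb.tot
          omega
        · simp only [State.setReg_reg, Expr.eval, BinOp.eval, h22, h24, h0, f21, hcell]
          refine ⟨by simp [hins hiD], ?_⟩
          rw [if_neg (by decide), if_neg (by decide), h23]
          refine ⟨fun h a ha haD => h a ?_ haD, fun h a ha => h a (by omega)⟩
          have : a ≠ i := by rintro rfl; exact haD hiD
          omega
      · have hiD : i ∉ D := by by_contra h; simp [hbit, h] at he
        -- Since `i ∉ D`, the gain is unchanged and only the clause `a = i` of the flag is new.
        have key : ∀ {x : ℕ}, (x = 0 ↔ (s'.reg 23 = 0 ∧ (i ≠ c → W c i ≠ 0))) →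
            (x = 0 ↔ ∀ a < i + 1, a ∉ D → a ≠ c → W c a ≠ 0) := by
          intro x hx
          rw [hx, h23]
          constructor
          · rintro ⟨h1, h2⟩ a ha haD
            by_cases e : a = i
            · rw [e]; exact h2
            · exact h1 a (by omega) haD
          · intro h
            exact ⟨fun a ha => h a (by omega), h i (by omega) hiD⟩
        refine Ev.le (Ev.ite (T := 3) (T' := 1) hb.pos (by decide) (fun hne => ?_) (fun he => ?_))
          (by omega)
        · have hic : i ≠ c := by rintro rfl; simp [h24, f21] at hne
          have hcell := hs'.maj c hc i hi
          refine Ev.le (Ev.ite (T := 1) (T' := 1) hb.pos (by decide) (fun hne => ?_) (fun he => ?_))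
            (by omega)
          · refine Ev.skip hb.pos ⟨by simpa [hnot hiD] using h22, key ?_⟩
            simp only [Expr.eval, BinOp.eval, h24, h0, f21, hcell] at hne
            simp [hne]
          · refine Ev.set hb.pos (by decide) (fun _ => by simpa using h1B)
              ⟨by simpa [hnot hiD] using h22, key ?_⟩
            simp only [Expr.eval, BinOp.eval, h24, h0, f21, hcell] at he
            simp [he, hic, Expr.eval]
        · have hic : i = c := by
            simp only [Expr.eval, BinOp.eval, h24, f21] at he; omega
          refine Ev.skip hb.pos ⟨by simpa [hnot hiD] using h22, key ?_⟩
          simp [hic]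
    · rintro s' ⟨-, h22, h23⟩
      rw [inter_eq_left.2 hD] at h22
      exact ⟨h22, h23⟩
  · omega

/-- The list and the table of the state `s`. -/
structure TabRel (s : State) (lst : List (Finset ℕ)) (tab : Finset ℕ → ℕ) : Prop where
  tab : ∀ D, s.arr 4 (mask D) = tab D
  len : s.reg 30 = lst.length
  list : ∀ j (h : j < lst.length), s.arr 5 j = mask lst[j]

theorem TabRel.congr {s s' : State} {lst : List (Finset ℕ)} {tab : Finset ℕ → ℕ}
    (h : TabRel s lst tab) (h4 : s'.arr 4 = s.arr 4) (h5 : s'.arr 5 = s.arr 5)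
    (h30 : s'.reg 30 = s.reg 30) : TabRel s' lst tab := by
  constructor
  · rw [h4]; exact h.tab
  · rw [h30]; exact h.len
  · rw [h5]; exact h.list

/-- This crude bound serves only to keep the length register below `2 ^ B`; the running time relies
on `length_le_of_reachable`. -/
theorem TabInv.length_le {m : ℕ} {W : ℕ → ℕ → ℕ} {lst : List (Finset ℕ)} {tab : Finset ℕ → ℕ}
    (h : TabInv m W lst tab) : lst.length ≤ 2 ^ m := by
  have : lst.toFinset ⊆ (range m).powerset := by
    intro D hD
    obtain ⟨l, hl⟩ := h.reachable (List.mem_toFinset.1 hD)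
    exact mem_powerset.2 hl.subset
  have := card_le_card this
  rwa [List.toFinset_card_of_nodup h.nodup, card_powerset, card_range] at this

theorem ev_relaxProg {B m n r : ℕ} (hb : Bounds B m n r) {W : ℕ → ℕ → ℕ} (hW : ∀ a b, W a b ≤ n)
    {s : State} (hs : Ctx m W s) {lst : List (Finset ℕ)} {tab : Finset ℕ → ℕ}
    (hinv : TabInv m W lst tab) (hrel : TabRel s lst tab)
    {D : Finset ℕ} (hD : D ∈ lst) (h20 : s.reg 20 = mask D)
    {c : ℕ} (hc : c < m) (h21 : s.reg 21 = c) :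
    Ev B relaxProg s (9 * (m + 1) + 14) (fun s' => Ctx m W s' ∧
      TabRel s' (relaxList m W lst tab D c) (relaxTab m W tab D c)) := by
  obtain ⟨l, hl, hv⟩ := hinv.sound D ((hinv.mem_iff D).1 hD)
  refine Ev.le (Ev.seq (T' := 14) ((ev_rankNext hb hW hs hl.subset h20 hc h21).frame.mono le_rfl ?_))
    le_rfl
  rintro s₁ ⟨F, h22, h23⟩
  have hs₁ : Ctx m W s₁ := hs.frame F (by decide) (by decide) (by decide)
  have hrel₁ : TabRel s₁ lst tab :=
    hrel.congr (F.arr 4 (by decide)) (F.arr 5 (by decide)) (F.reg 30 (by decide))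
  rw [← F.reg 20 (by decide)] at h20
  rw [← F.reg 21 (by decide)] at h21
  have hbit := eval_bitOf hs₁ h20 (y := 21) (by omega)
  rw [h21] at hbit
  have same : ¬ Ok m W D c → TabRel s₁ (relaxList m W lst tab D c) (relaxTab m W tab D c) := by
    intro hok
    simpa [relaxList, relaxTab, hok] using hrel₁
  refine Ev.le (Ev.ite (T := 1) (T' := 11) hb.pos (by decide) (fun hne => ?_) (fun he => ?_))
    (by omega)
  · refine Ev.skip hb.pos ⟨hs₁, same fun hok => ?_⟩
    simp [hbit, hok.2.1] at hne
  have hcD : c ∉ D := by by_contra h; simp [hbit, h] at he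
  refine Ev.le (Ev.ite (T := 1) (T' := 9) hb.pos (by decide) (fun hne => ?_) (fun he => ?_))
    (by omega)
  · refine Ev.skip hb.pos ⟨hs₁, same fun hok => ?_⟩
    exact hne (by simpa [Expr.eval] using h23.2 hok.2.2)
  have hok : Ok m W D c := ⟨hc, hcD, h23.1 (by simpa [Expr.eval] using he)⟩
  obtain ⟨hl', hv'⟩ := path_concat hl hok
  have hmask : mask D + 2 ^ c = mask (insert c D) := (mask_insert hcD).symm
  have hpow : s₁.arr 3 c = 2 ^ c := hs₁.pow c hc.le
  refine Ev.le (Ev.setSeq (T := 8) hb.pos (by decide) (fun _ => ?_) ?_) (by omega)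
  · simp only [Expr.eval, BinOp.eval, h20, h21, hpow, hmask]
    have := mask_lt hl'.subset
    have := hb.pow
    omega
  refine Ev.le (Ev.setSeq (T := 7) hb.pos (by decide) (fun _ => ?_) ?_) (by omega)
  -- The new value is one more than the gain of an actual path, hence at most `n * m * m + 1`.
  · have := gainSum_le hW hl'
    have := hb.tot
    simp [Expr.eval, BinOp.eval, h20, h22, hrel₁.tab]
    omega
  simp only [Expr.eval, BinOp.eval, h20, h21, hpow, hmask, State.setReg_reg, State.setReg_arr, h22,
    hrel₁.tab, Nat.reduceEqDiff, if_false]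
  set s₂ := (s₁.setReg 34 (mask (insert c D))).setReg 35 (tab D + gain W D c) with hs₂
  have r34 : s₂.reg 34 = mask (insert c D) := by simp [hs₂]
  have r35 : s₂.reg 35 = tab D + gain W D c := by simp [hs₂]
  have hc₂ : Ctx m W s₂ := hs₁.congr (by simp [hs₂]) (by simp [hs₂]) (by simp [hs₂])
  have hrel₂ : TabRel s₂ lst tab := hrel₁.congr (by simp [hs₂]) (by simp [hs₂]) (by simp [hs₂])
  refine Ev.le (Ev.seq (T := 4) (T' := 3) ?_) le_rfl
  -- The final comparison is reached with or without a new list entry. In both cases the list is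
  -- already updated and the table is not.
  have cont : ∀ s₃ : State, s₃.reg 34 = mask (insert c D) → s₃.reg 35 = tab D + gain W D c →
      Ctx m W s₃ → TabRel s₃ (relaxList m W lst tab D c) tab →
      Ev B (.ite (.bin .sub (.reg 35) (.load 4 (.reg 34))) (.store 4 (.reg 34) (.reg 35)) .skip) s₃ 3
        (fun s' => Ctx m W s' ∧
          TabRel s' (relaxList m W lst tab D c) (relaxTab m W tab D c)) := by
    intro s₃ a34 a35 hc₃ hrel₃
    refine Ev.le (Ev.ite (T := 1) (T' := 1) hb.pos (by decide) (fun hne => ?_) (fun he => ?_))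
      (by omega)
    · simp only [Expr.eval, BinOp.eval, a34, a35, hrel₃.tab] at hne
      refine Ev.store hb.pos (by decide) (fun hg => by simpa [Expr.eval] using hg.reg 35) ?_
      refine ⟨hc₃.congr (by simp) (by funext; simp) (by funext; simp), fun E => ?_, ?_, ?_⟩
      · simp only [Expr.eval, State.setArr_arr, a34, a35, true_and, mask_injective.eq_iff,
          relaxTab, hok, if_true, Function.update_apply, hrel₃.tab]
        split_ifs
        · rw [max_eq_right (by omega)]
        · rfl
      · simpa using hrel₃.len
      · simpa using hrel₃.list
    · simp only [Expr.eval, BinOp.eval, a34, a35, hrel₃.tab] at he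
      refine Ev.skip hb.pos ⟨hc₃, fun E => ?_, hrel₃.len, hrel₃.list⟩
      simp only [relaxTab, hok, if_true, Function.update_apply, hrel₃.tab]
      split_ifs with h
      · rw [max_eq_left (by omega), h]
      · rfl
  refine Ev.le (Ev.ite (T := 1) (T' := 2) hb.pos (by decide) (fun hne => ?_) (fun he => ?_))
      (by omega)
  · simp only [Expr.eval, r34, hrel₂.tab] at hne
    exact Ev.skip hb.pos (cont s₂ r34 r35 hc₂ (by simpa [relaxList, hne] using hrel₂))
  · simp only [Expr.eval, r34, hrel₂.tab] at he
    refine Ev.storeSeq (T := 1) hb.pos (by decide)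
      (fun hg => by simpa [Expr.eval] using hg.reg 34) ?_
    refine Ev.set hb.pos (by decide) (fun _ => ?_) (cont _ ?_ ?_ ?_ ⟨?_, ?_, ?_⟩)
    · have := hinv.length_le
      have := hb.pow
      have := Nat.two_pow_pos m
      simp [Expr.eval, BinOp.eval, hrel₂.len]
      omega
    · simpa using r34
    · simpa using r35
    · exact hc₂.congr (by simp) (by funext; simp) (by funext; simp)
    · simpa using hrel₂.tab
    · simp [Expr.eval, BinOp.eval, hrel₂.len, relaxList, hok, he]
    · intro j hj
      have hlist : relaxList m W lst tab D c = lst ++ [insert c D] := by simp [relaxList, hok, he]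
      simp only [hlist, List.length_append, List.length_singleton] at hj
      simp only [State.setReg_arr, State.setArr_arr, true_and, Expr.eval, hrel₂.len, r34, hlist,
        List.getElem_append]
      split_ifs with h1 h2 h2
      · omega
      · simp [h1]
      · exact hrel₂.list j h2
      · omega

/-- The time of the computation of the table, if there are at most `M` reachable sets. -/
def tableTime (m M : ℕ) : ℕ := 5 + m * (M * (m * (9 * (m + 1) + 16) + 5) + 5)

/-- Each of the `m` rounds goes through the list as it stood at the start of the round (its length
is frozen in register `32`) and makes the table optimal for sets with one more element. The bound
`M` stays abstract here; the width enters later. -/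
theorem ev_tableProg {B m n r M : ℕ} (hb : Bounds B m n r) {W : ℕ → ℕ → ℕ}
    (hW : ∀ a b, W a b ≤ n) (hM : ∀ lst tab, TabInv m W lst tab → lst.length ≤ M)
    {s : State} (hs : Ctx m W s) (h4 : ∀ i, s.arr 4 i = 0) :
    Ev B tableProg s (tableTime m M) (fun s' => Ctx m W s' ∧ ∃ lst tab, TabInv m W lst tab ∧
      TabRel s' lst tab ∧ CompleteUpTo m W m tab) := by
  have h1B : 1 < 2 ^ B := by have := hb.tot; omega
  refine Ev.le (Ev.storeSeq hb.pos (by decide) (fun _ => by simpa [Expr.eval] using h1B)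
    (Ev.setSeq hb.pos (by decide) (fun _ => by simpa [Expr.eval] using h1B)
    (Ev.storeSeq (T := m * (M * (m * (9 * (m + 1) + 16) + 5) + 5) + 2) hb.pos (by decide)
      (fun _ => by simp [Expr.eval]) ?_))) ?_
  swap
  · unfold tableTime; omega
  set s₁ := State.setArr _ _ _ _ with hs₁
  have hc₁ : Ctx m W s₁ := hs.congr (by simp [hs₁]) (by funext; simp [hs₁]) (by funext; simp [hs₁])
  have hrel₁ : TabRel s₁ [∅] (fun D => if D = ∅ then 1 else 0) := by
    refine ⟨fun D => ?_, by simp [hs₁, Expr.eval], ?_⟩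
    · have : mask D = 0 ↔ D = ∅ := by
        rw [← mask_injective.eq_iff (a := D)]; simp [mask]
      simp [hs₁, Expr.eval, h4, this]
    · intro j hj
      obtain rfl : j = 0 := by simpa using hj
      simp [hs₁, Expr.eval, mask]
  refine (Ev.forLoop m ?_ hb.pos (by decide) (by decide) (by decide)
    (fun k s' => Ctx m W s' ∧ ∃ lst tab, TabInv m W lst tab ∧
      TabRel s' lst tab ∧ CompleteUpTo m W k tab) ?_ ?_).mono le_rfl fun _ h => h.2
  · exact hc₁.reg
  · refine ⟨hc₁.congr (by simp) rfl rfl, _, _, TabInv.init.1,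
      hrel₁.congr rfl rfl (by simp), TabInv.init.2⟩
  · rintro k hk s₂ - - - ⟨hc₂, lst₀, tab₀, hinv₀, hrel₂, hcomp⟩
    have hlen₀ := hM _ _ hinv₀
    refine Ev.le (Ev.setSeq (T := lst₀.length * ((1 + (m * ((9 * (m + 1) + 14) + 2) + 2)) + 2) + 2)
      hb.pos (by decide) (fun hg => by simpa [Expr.eval] using hg.reg 30) ?_) ?_
    swap
    · have := Nat.mul_le_mul_right (m * (9 * (m + 1) + 16) + 5) hlen₀
      have e : 1 + (m * (9 * (m + 1) + 14 + 2) + 2) + 2 = m * (9 * (m + 1) + 16) + 5 := by ring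
      rw [e]; omega
    refine (Ev.forLoop lst₀.length ?_ hb.pos (by decide) (by decide) (by decide)
      (fun j s' => Ctx m W s' ∧ ∃ lst tab, RoundInv m W k lst₀ j 0 lst tab ∧
        TabRel s' lst tab) ?_ ?_).mono le_rfl ?_
    · simp [Expr.eval, hrel₂.len]
    · exact ⟨hc₂.congr (by simp) rfl rfl, _, _, RoundInv.start hinv₀ hcomp,
        hrel₂.congr rfl rfl (by simp)⟩
    · rintro j hj s₃ - h33 - ⟨hc₃, lst, tab, hinv, hrel₃⟩
      have hmem : lst₀[j] ∈ lst := hinv.pre.subset (List.getElem_mem hj)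
      -- The list only grows at its end, so the old entries keep their addresses.
      have h5 : s₃.arr 5 j = mask lst₀[j] := by
        have := hrel₃.list j (hj.trans_le hinv.pre.length_le)
        rw [this, hinv.pre.getElem hj]
      refine Ev.setSeq hb.pos (by decide) (fun hg => by simpa [Expr.eval] using hg.arr 5 _) ?_
      refine (Ev.forLoop m ?_ hb.pos (by decide) (by decide) (by decide)
        (fun c s' => Ctx m W s' ∧ ∃ lst tab, RoundInv m W k lst₀ j c lst tab ∧
          TabRel s' lst tab) ?_ ?_).mono le_rfl ?_
      · simpa using hc₃.reg
      · exact ⟨hc₃.congr (by simp) rfl rfl, _, _, hinv, hrel₃.congr rfl rfl (by simp)⟩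
      · rintro c hc s₄ F h21 - ⟨hc₄, lst, tab, hinv, hrel₄⟩
        have h20 : s₄.reg 20 = mask lst₀[j] := by
          rw [F.reg 20 (by decide)]; simp [Expr.eval, h33, h5]
        refine (ev_relaxProg hb hW hc₄ hinv.toTabInv hrel₄
          (hinv.pre.subset (List.getElem_mem hj)) h20 hc h21).mono le_rfl ?_
        rintro s₅ ⟨hc₅, hrel₅⟩
        exact ⟨hc₅.congr (by simp) rfl rfl, _, _, hinv.relax hj, hrel₅.congr rfl rfl (by simp)⟩
      · rintro s₄ ⟨-, hc₄, lst, tab, hinv, hrel₄⟩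
        exact ⟨hc₄.congr (by simp) rfl rfl, _, _, hinv.next, hrel₄.congr rfl rfl (by simp)⟩
    · rintro s₃ ⟨-, hc₃, lst, tab, hinv, hrel₃⟩
      exact ⟨hc₃.congr (by simp) rfl rfl, _, _, hinv.toTabInv, hrel₃.congr rfl rfl (by simp),
        hinv.finish⟩

/-- Extend the suffix at the address in register `46`, the set of whose missing candidates is in
register `47`, by the candidate `21`. -/
def extendProg : Prog :=
  .ite (.reg 41 +ₑ .reg 2 -ₑ .reg 43)
    (.ite (bitOf 47 21)
      (.set 20 (.reg 47 -ₑ .load 3 (.reg 21)) ;; rankNext ;;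
        .ite (.load 4 (.reg 20))
          (.ite (.load 4 (.reg 20) +ₑ .reg 22 +ₑ .load 7 (.reg 46) -ₑ .reg 3)
            (.store 6 (.reg 43) (.reg 20) ;;
              .store 7 (.reg 43) (.reg 22 +ₑ .load 7 (.reg 46)) ;;
              .store 8 (.reg 43) (.reg 21 +ₑ .reg 0 *ₑ .load 8 (.reg 46)) ;;
              .set 43 (.reg 43 +ₑ .const 1)) .skip) .skip) .skip) .skip

/-- The suffixes at the addresses from register `40` to register `41` are extended. -/
def levelProg : Prog :=
  .set 43 (.reg 41) ;; .set 44 (.reg 41 -ₑ .reg 40) ;;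
  forLoop 45 44 (.set 46 (.reg 40 +ₑ .reg 45) ;; .set 47 (.load 6 (.reg 46)) ;;
    forLoop 21 0 extendProg) ;;
  .set 40 (.reg 41) ;; .set 41 (.reg 43)

/-- The enumeration of the words from their suffixes. -/
def enumProg : Prog :=
  .store 6 (.const 0) (.load 3 (.reg 0) -ₑ .const 1) ;; .store 7 (.const 0) (.const 0) ;;
  .store 8 (.const 0) (.const 0) ;; .set 40 (.const 0) ;; .set 41 (.const 1) ;;
  forLoop 42 0 levelProg

/-- The words are decoded and written to the output. -/
def outputProg : Prog :=
  .set 44 (.reg 41 -ₑ .reg 40) ;; .store 1 (.const 0) (.reg 44) ;;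
  forLoop 45 44 (.set 47 (.load 8 (.reg 40 +ₑ .reg 45)) ;;
    forLoop 21 0 (.store 1 (.const 1 +ₑ (.reg 45 *ₑ .reg 0 +ₑ .reg 21))
        (.reg 47 -ₑ .reg 0 *ₑ (.reg 47 /ₑ .reg 0)) ;;
      .set 47 (.reg 47 /ₑ .reg 0)))

/-! ### Correctness and time of the enumeration and the output -/

theorem ofDigits_lt_pow {m : ℕ} {l : List ℕ} (h : ∀ c ∈ l, c < m) :
    Nat.ofDigits m l < m ^ l.length := by
  induction l with
  | nil => simp
  | cons c l ih =>
    have h1 := ih fun a ha => h a (by simp [ha])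
    have h2 := h c (by simp)
    rw [Nat.ofDigits_cons, List.length_cons, pow_succ]
    nlinarith

/-- The suffixes in `E` are stored from the address `b` on. -/
structure EntRel (m : ℕ) (W : ℕ → ℕ → ℕ) (s : State) (b : ℕ) (E : List (List ℕ)) : Prop where
  set : ∀ j (h : j < E.length), s.arr 6 (b + j) = mask (range m \ E[j].toFinset)
  gain : ∀ j (h : j < E.length), s.arr 7 (b + j) = gainSum W (range m \ E[j].toFinset) E[j]
  code : ∀ j (h : j < E.length), s.arr 8 (b + j) = Nat.ofDigits m E[j]

theorem EntRel.congr {m : ℕ} {W : ℕ → ℕ → ℕ} {s s' : State} {b : ℕ} {E : List (List ℕ)}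
    (h : EntRel m W s b E) (h' : ∀ a, 6 ≤ a → a ≤ 8 → s'.arr a = s.arr a) :
    EntRel m W s' b E := by
  constructor
  · rw [h' 6 (by norm_num) (by norm_num)]; exact h.set
  · rw [h' 7 (by norm_num) (by norm_num)]; exact h.gain
  · rw [h' 8 (by norm_num) (by norm_num)]; exact h.code

/-- The part of the memory that is fixed during the enumeration. -/
structure EnumCtx (m : ℕ) (W : ℕ → ℕ → ℕ) (tab : Finset ℕ → ℕ) (thr r : ℕ) (s : State) : Prop
    extends Ctx m W s where
  tab : ∀ D, s.arr 4 (mask D) = tab D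
  thr : s.reg 3 = thr
  num : s.reg 2 = r

theorem EnumCtx.congr {m : ℕ} {W : ℕ → ℕ → ℕ} {tab : Finset ℕ → ℕ} {thr r : ℕ} {s s' : State}
    (h : EnumCtx m W tab thr r s) (hr : ∀ x ≤ 3, s'.reg x = s.reg x)
    (ha : ∀ a, 2 ≤ a → a ≤ 4 → s'.arr a = s.arr a) : EnumCtx m W tab thr r s' where
  toCtx := h.toCtx.congr (hr 0 (by norm_num)) (ha 2 (by norm_num) (by norm_num))
    (ha 3 (by norm_num) (by norm_num))
  tab := by rw [ha 4 (by norm_num) (by norm_num)]; exact h.tab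
  thr := by rw [hr 3 (by norm_num)]; exact h.thr
  num := by rw [hr 2 (by norm_num)]; exact h.num

/-- Cutting after each append amounts to cutting once at the end, so the program may simply stop
appending when `r` suffixes are stored. -/
theorem take_take_append {α : Type*} (r : ℕ) (A C : List α) :
    (A.take r ++ C).take r = (A ++ C).take r := by
  rw [List.take_append, List.take_append, List.take_take, min_self, List.length_take]
  congr 2
  omega

/-- The hypotheses on the table under which suffixes are extended correctly. -/
structure TableOK (m n : ℕ) (W : ℕ → ℕ → ℕ) (lst : List (Finset ℕ)) (tab : Finset ℕ → ℕ) :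
    Prop where
  le : ∀ a b, W a b ≤ n
  inv : TabInv m W lst tab
  complete : CompleteUpTo m W m tab

/-- After the test for a free place, the nested tests are the three conditions of `cons_suffix_iff`.
The admissibility flag of `rankNext` is not consulted: admissibility follows from the closure of
reachable sets. -/
theorem ev_extendProg {B m n r : ℕ} (hb : Bounds B m n r) {W : ℕ → ℕ → ℕ}
    {lst : List (Finset ℕ)} {tab : Finset ℕ → ℕ} (ht : TableOK m n W lst tab)
    {thr : ℕ} {s : State} (hs : EnumCtx m W tab thr r s) {lo : ℕ} {E F : List (List ℕ)} {i : ℕ}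
    (hi : i < E.length) (hE : EntRel m W s lo E) (hF : EntRel m W s (lo + E.length) F)
    (hl : ∃ u, u ++ E[i] ∈ goodWords m W thr)
    (hsz : lo + E.length + r < 2 ^ B) (hFr : F.length ≤ r)
    (h41 : s.reg 41 = lo + E.length) (h43 : s.reg 43 = lo + E.length + F.length)
    (h46 : s.reg 46 = lo + i) (h47 : s.reg 47 = mask (range m \ E[i].toFinset))
    {c : ℕ} (hc : c < m) (h21 : s.reg 21 = c) :
    Ev B extendProg s (9 * (m + 1) + 13) (fun s' => EnumCtx m W tab thr r s' ∧
      EntRel m W s' lo E ∧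
      EntRel m W s' (lo + E.length) ((F ++ child (goodWords m W thr) E[i] c).take r) ∧
      s'.reg 43 = lo + E.length + ((F ++ child (goodWords m W thr) E[i] c).take r).length) := by
  set l := E[i] with hldef
  set D := range m \ l.toFinset with hDdef
  have hiff := cons_suffix_iff ht.inv ht.complete hl c
  rw [← hDdef] at hiff
  have hno : (¬ ∃ u, u ++ c :: l ∈ goodWords m W thr) →
      (F ++ child (goodWords m W thr) l c).take r = F := by
    intro h
    rw [child, if_neg h, List.append_nil, List.take_of_length_le hFr]
  refine Ev.le (Ev.ite (T := 9 * (m + 1) + 11) (T' := 1) hb.pos (by decide) (fun hne => ?_)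
    (fun he => ?_)) (by omega)
  swap
  -- The level already holds `r` suffixes, and the cut discards any child.
  · refine Ev.skip hb.pos ?_
    simp only [Expr.eval, BinOp.eval, h41, h43, hs.num] at he
    have hlen : F.length = r := by omega
    have : (F ++ child (goodWords m W thr) l c).take r = F := by
      rw [← hlen, List.take_left]
    rw [this]
    exact ⟨hs, hE, hF, h43⟩
  have hlt : F.length < r := by
    simp only [Expr.eval, BinOp.eval, h41, h43, hs.num] at hne
    omega
  have hbit := eval_bitOf hs.toCtx h47 (y := 21) (by omega)
  rw [h21] at hbit
  refine Ev.le (Ev.ite (T := 9 * (m + 1) + 9) (T' := 1) hb.pos (by decide) (fun hne => ?_)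
    (fun he => ?_)) (by omega)
  swap
  · have hcD : c ∉ D := by by_contra h; simp [hbit, h] at he
    rw [hno fun h => hcD (hiff.1 h).1]
    exact Ev.skip hb.pos ⟨hs, hE, hF, h43⟩
  have hcD : c ∈ D := by by_contra h; simp [hbit, h] at hne
  have hDm : D.erase c ⊆ range m := (erase_subset _ _).trans sdiff_subset
  have hmask : mask D - 2 ^ c = mask (D.erase c) := (mask_erase hcD).symm
  refine Ev.le (Ev.setSeq (T := 9 * (m + 1) + 8) hb.pos (by decide) (fun _ => ?_) ?_) (by omega)
  · simp only [Expr.eval, BinOp.eval, h47, h21, hs.pow c hc.le, hmask]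
    have := mask_lt hDm
    have := hb.pow
    omega
  simp only [Expr.eval, BinOp.eval, h47, h21, hs.pow c hc.le, hmask]
  have hs₀ : Ctx m W (s.setReg 20 (mask (D.erase c))) := hs.toCtx.congr (by simp) rfl rfl
  refine Ev.seq ((ev_rankNext hb ht.le hs₀ hDm
    (by simp) hc (by simpa using h21)).frame.mono le_rfl ?_)
  rintro s₁ ⟨F₁, h22, -⟩
  have freg : ∀ x, rankNext.modReg x = false → x ≠ 20 → s₁.reg x = s.reg x := by
    intro x hx h20
    rw [F₁.reg x hx]; simp [h20]
  have farr : s₁.arr = s.arr := by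
    funext a
    exact F₁.arr a rfl
  have hs₁ : EnumCtx m W tab thr r s₁ := hs.congr
    (fun x hx => freg x (by interval_cases x <;> decide) (by omega)) (fun _ _ _ => by rw [farr])
  have hE₁ : EntRel m W s₁ lo E := hE.congr fun _ _ _ => by rw [farr]
  have hF₁ : EntRel m W s₁ (lo + E.length) F := hF.congr fun _ _ _ => by rw [farr]
  rw [← freg 43 (by decide) (by decide)] at h43
  rw [← freg 46 (by decide) (by decide)] at h46
  rw [← freg 21 (by decide) (by decide)] at h21
  have h20 : s₁.reg 20 = mask (D.erase c) := by rw [F₁.reg 20 (by decide)]; simp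
  have hacc : s₁.arr 7 (lo + i) = gainSum W D l := hE₁.gain i hi
  have hcode : s₁.arr 8 (lo + i) = Nat.ofDigits m l := hE₁.code i hi
  refine Ev.le (Ev.ite (T := 6) (T' := 1) hb.pos (by decide) (fun hne => ?_)
    (fun he => ?_)) (by omega)
  swap
  · simp only [Expr.eval, h20, hs₁.tab] at he
    rw [hno fun h => (hiff.1 h).2.1 he]
    exact Ev.skip hb.pos ⟨hs₁, hE₁, hF₁, h43⟩
  simp only [Expr.eval, h20, hs₁.tab] at hne
  refine Ev.le (Ev.ite (T := 4) (T' := 1) hb.pos (by decide) (fun hne' => ?_)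
    (fun he => ?_)) (by omega)
  swap
  · simp only [Expr.eval, BinOp.eval, h20, h22, h46, hacc, hs₁.thr, hs₁.tab] at he
    rw [hno fun h => by have := (hiff.1 h).2.2; omega]
    exact Ev.skip hb.pos ⟨hs₁, hE₁, hF₁, h43⟩
  simp only [Expr.eval, BinOp.eval, h20, h22, h46, hacc, hs₁.thr, hs₁.tab] at hne'
  have hgood : ∃ u, u ++ c :: l ∈ goodWords m W thr := hiff.2 ⟨hcD, hne, by omega⟩
  have hnew : (F ++ child (goodWords m W thr) l c).take r = F ++ [c :: l] := by
    rw [child, if_pos hgood, List.take_of_length_le]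
    simp; omega
  rw [hnew]
  have hset : range m \ (c :: l).toFinset = D.erase c := by
    ext a; simp [hDdef]; tauto
  obtain ⟨u, hu, -⟩ := hgood
  -- The gain of the longer suffix is part of the total gain of a word that it completes.
  have hsum : gain W (D.erase c) c + gainSum W D l ≤ n * m * m := by
    refine le_trans ?_ (gainSum_le ht.le hu)
    obtain ⟨G, hG, hok, hGl⟩ := path_append.1 hu
    have hGD : insert c G = D := by
      have h1 := Path.eq hGl
      have h2 := (Path.nodup hGl).2.1
      ext a
      rw [hDdef, h1]
      simp only [mem_sdiff, mem_union, List.mem_toFinset]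
      have := h2 a
      tauto
    rw [gainSum_append, empty_union, ← hG.eq_toFinset, gainSum, ← hGD, erase_insert hok.2.1]
    omega
  have hdig : Nat.ofDigits m (c :: l) < 2 ^ B := by
    have h1 : ∀ a ∈ c :: l, a < m := fun a ha => hu.nodup.2.2 a (List.mem_append_right _ ha)
    have h2 : (c :: l).length ≤ m := by
      have : #(range m) = _ := hu.card
      rw [card_range, List.length_append] at this
      omega
    have h3 : m ^ (c :: l).length ≤ m ^ m := Nat.pow_le_pow_right (by omega) h2
    have := ofDigits_lt_pow h1
    have := hb.code
    omega
  refine Ev.storeSeq (T := 3) hb.pos (by decide) (fun hg => by simpa [Expr.eval] using hg.reg 20) ?_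
  refine Ev.storeSeq (T := 2) hb.pos (by decide) (fun _ => ?_) ?_
  · have := hb.tot
    simp only [Expr.eval, BinOp.eval, State.setArr_arr, State.setArr_reg, h22, h46]
    rw [if_neg (by simp), hacc]
    omega
  refine Ev.storeSeq (T := 1) hb.pos (by decide) (fun _ => ?_) ?_
  · rw [Nat.ofDigits_cons] at hdig
    simpa [Expr.eval, BinOp.eval, h46, h21, hs₁.reg, hcode] using hdig
  refine Ev.set hb.pos (by decide) (fun _ => ?_) ⟨?_, ?_, ?_, ?_⟩
  · simp only [Expr.eval, BinOp.eval, State.setArr_reg, h43]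
    omega
  · refine hs₁.congr (fun x hx => ?_) (fun a h2 h4 => ?_)
    · simp; omega
    · funext j
      simp only [State.setReg_arr, State.setArr_arr]
      rw [if_neg (by omega), if_neg (by omega), if_neg (by omega)]
  -- The new cell lies behind all cells of the level `E`, which is therefore intact.
  · constructor
    · intro j hj
      simpa [Expr.eval, h43, show ¬ (lo + j = lo + E.length + F.length) by omega] using hE₁.set j hj
    · intro j hj
      simpa [Expr.eval, h43, show ¬ (lo + j = lo + E.length + F.length) by omega] using hE₁.gain j hj
    · intro j hj
      simpa [Expr.eval, h43, show ¬ (lo + j = lo + E.length + F.length) by omega] using hE₁.code j hj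
  · have hcase : ∀ j, j < (F ++ [c :: l]).length → j < F.length ∨ j = F.length := by
      intro j hj; simp at hj; omega
    constructor
    · intro j hj
      rcases hcase j hj with h | rfl
      · simpa [Expr.eval, h43, h.ne, List.getElem_append_left h] using hF₁.set j h
      · simp only [State.setReg_arr, State.setArr_arr, Expr.eval, h43, List.getElem_concat_length, hset]
        simp [h20]
    · intro j hj
      rcases hcase j hj with h | rfl
      · simpa [Expr.eval, h43, h.ne, List.getElem_append_left h] using hF₁.gain j h
      · simp only [State.setReg_arr, State.setArr_arr, Expr.eval, h43, List.getElem_concat_length,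
          hset, gainSum, insert_erase hcD]
        simp [h22, h46, hacc, h43, BinOp.eval]
    · intro j hj
      rcases hcase j hj with h | rfl
      · simpa [Expr.eval, h43, h.ne, List.getElem_append_left h] using hF₁.code j h
      · simp only [State.setReg_arr, State.setArr_arr, Expr.eval, h43, List.getElem_concat_length,
          Nat.ofDigits_cons]
        simp [h46, hcode, h43, BinOp.eval, h21, hs₁.reg]
  · simp [Expr.eval, BinOp.eval, h43]; ring

/-- The time of the extension of a level of at most `r` suffixes. -/
def levelTime (m r : ℕ) : ℕ := r * (m * (9 * (m + 1) + 15) + 6) + 6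

/-- The new level is written directly behind the old one. The loops over suffixes and letters follow
the two `flatMap`s of `nextLevel`, and `take_take_append` moves the cut to the end. -/
theorem ev_levelProg {B m n r : ℕ} (hb : Bounds B m n r) {W : ℕ → ℕ → ℕ}
    {lst : List (Finset ℕ)} {tab : Finset ℕ → ℕ} (ht : TableOK m n W lst tab)
    {thr : ℕ} {s : State} (hs : EnumCtx m W tab thr r s) {lo : ℕ} {E : List (List ℕ)}
    (hE : EntRel m W s lo E) (hEr : E.length ≤ r)
    (hl : ∀ l ∈ E, ∃ u, u ++ l ∈ goodWords m W thr)
    (hsz : lo + E.length + r < 2 ^ B) (h40 : s.reg 40 = lo) (h41 : s.reg 41 = lo + E.length) :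
    Ev B levelProg s (levelTime m r) (fun s' => EnumCtx m W tab thr r s' ∧
      EntRel m W s' (lo + E.length) (nextLevel (goodWords m W thr) m r E) ∧
      s'.reg 40 = lo + E.length ∧
      s'.reg 41 = lo + E.length + (nextLevel (goodWords m W thr) m r E).length) := by
  set K := goodWords m W thr with hK
  set ch : List ℕ → List (List ℕ) := fun l => (List.range m).flatMap fun c => child K l c with hch
  refine Ev.le (Ev.setSeq hb.pos (by decide) (fun hg => by simpa [Expr.eval] using hg.reg 41)
    (Ev.setSeq (T := (E.length * ((1 + (1 + (m * ((9 * (m + 1) + 13) + 2) + 2))) + 2) + 2) + 2)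
    hb.pos (by decide) (fun _ => ?_) (Ev.seq ?_))) ?_
  · simp [Expr.eval, BinOp.eval, h40, h41]; omega
  · refine (Ev.forLoop E.length ?_ hb.pos (by decide) (by decide) (by decide)
      (fun i s' => EnumCtx m W tab thr r s' ∧ EntRel m W s' lo E ∧
        EntRel m W s' (lo + E.length) (((E.take i).flatMap ch).take r) ∧
        s'.reg 43 = lo + E.length + (((E.take i).flatMap ch).take r).length)
      ?_ ?_).mono le_rfl ?_
    · simp [Expr.eval, BinOp.eval, h40, h41]
    · refine ⟨hs.congr (fun x hx => ?_) (fun _ _ _ => rfl), hE.congr (fun _ _ _ => rfl), ?_, ?_⟩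
      · interval_cases x <;> simp
      · constructor <;> simp
      · simp [Expr.eval, h41]
    · rintro i hi s₁ F h45 - ⟨hs₁, hE₁, hF₁, h43⟩
      have a40 : s₁.reg 40 = lo := by rw [F.reg 40 (by decide)]; simp [h40]
      have a41 : s₁.reg 41 = lo + E.length := by rw [F.reg 41 (by decide)]; simp [h41]
      refine Ev.setSeq hb.pos (by decide) (fun _ => ?_)
        (Ev.setSeq hb.pos (by decide) (fun hg => by simpa [Expr.eval] using hg.arr 6 _) ?_)
      · simp [Expr.eval, BinOp.eval, a40, h45]; omega
      refine (Ev.forLoop m ?_ hb.pos (by decide) (by decide) (by decide)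
        (fun c s' => EnumCtx m W tab thr r s' ∧ EntRel m W s' lo E ∧
          EntRel m W s' (lo + E.length) (((E.take i).flatMap ch ++
            (List.range c).flatMap fun d => child K E[i] d).take r) ∧
          s'.reg 43 = lo + E.length + (((E.take i).flatMap ch ++
            (List.range c).flatMap fun d => child K E[i] d).take r).length)
        ?_ ?_).mono le_rfl ?_
      · simpa using hs₁.reg
      · refine ⟨hs₁.congr (fun x hx => ?_) (fun _ _ _ => rfl), hE₁.congr (fun _ _ _ => rfl), ?_, ?_⟩
        · interval_cases x <;> simp
        · rw [List.range_zero, List.flatMap_nil, List.append_nil]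
          exact hF₁.congr (fun _ _ _ => rfl)
        · simpa using h43
      · rintro c hc s₂ F₂ h21 - ⟨hs₂, hE₂, hF₂, h43'⟩
        have b41 : s₂.reg 41 = lo + E.length := by rw [F₂.reg 41 (by decide)]; simp [a41]
        have b46 : s₂.reg 46 = lo + i := by
          rw [F₂.reg 46 (by decide)]; simp [Expr.eval, BinOp.eval, a40, h45]
        have b47 : s₂.reg 47 = mask (range m \ E[i].toFinset) := by
          rw [F₂.reg 47 (by decide)]
          simp [Expr.eval, BinOp.eval, a40, h45, hE₁.set i hi]
        refine (ev_extendProg hb ht hs₂ hi hE₂ hF₂ (hl _ (List.getElem_mem hi)) hsz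
          (List.length_take_le _ _) b41 h43' b46 b47 hc h21).mono le_rfl ?_
        rintro s₃ ⟨hs₃, hE₃, hF₃, h43''⟩
        have e : ((E.take i).flatMap ch ++
            (List.range (c + 1)).flatMap fun d => child K E[i] d) =
            ((E.take i).flatMap ch ++ (List.range c).flatMap fun d => child K E[i] d) ++
              child K E[i] c := by
          simp [List.range_succ]
        rw [take_take_append, ← e] at hF₃ h43''
        refine ⟨hs₃.congr (fun x hx => ?_) (fun _ _ _ => rfl), hE₃.congr (fun _ _ _ => rfl),
          hF₃.congr (fun _ _ _ => rfl), ?_⟩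
        · interval_cases x <;> simp
        · simpa using h43''
      · rintro s₂ ⟨-, hs₂, hE₂, hF₂, h43'⟩
        have e : (E.take (i + 1)).flatMap ch = (E.take i).flatMap ch ++ ch E[i] := by
          rw [List.take_succ_eq_append_getElem hi, List.flatMap_append]
          simp
        rw [e]
        refine ⟨hs₂.congr (fun x hx => ?_) (fun _ _ _ => rfl), hE₂.congr (fun _ _ _ => rfl),
          hF₂.congr (fun _ _ _ => rfl), ?_⟩
        · interval_cases x <;> simp
        · rw [State.setReg_reg, if_neg (by decide)]
          exact h43'
    · rintro s₁ ⟨F, hs₁, hE₁, hF₁, h43⟩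
      rw [List.take_length] at hF₁ h43
      have a41 : s₁.reg 41 = lo + E.length := by rw [F.reg 41 (by decide)]; simp [h41]
      refine Ev.setSeq (T := 1) hb.pos (by decide) (fun hg => by simpa [Expr.eval] using hg.reg 41)
        (Ev.set hb.pos (by decide) (fun hg => by simpa [Expr.eval] using hg.reg 43) ?_)
      refine ⟨hs₁.congr (fun x hx => ?_) (fun _ _ _ => rfl), hF₁.congr (fun _ _ _ => rfl), ?_, ?_⟩
      · interval_cases x <;> simp
      · simp [Expr.eval, a41]
      · rw [State.setReg_reg, if_pos rfl]
        exact h43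
  · have := Nat.mul_le_mul_right (m * (9 * (m + 1) + 15) + 6) hEr
    have e : (1 + (1 + (m * ((9 * (m + 1) + 13) + 2) + 2))) + 2 = m * (9 * (m + 1) + 15) + 6 := by
      ring
    unfold levelTime
    rw [e]; omega

theorem ev_enumProg {B m n r : ℕ} (hb : Bounds B m n r) {W : ℕ → ℕ → ℕ}
    {lst : List (Finset ℕ)} {tab : Finset ℕ → ℕ} (ht : TableOK m n W lst tab)
    {thr : ℕ} {s : State} (hs : EnumCtx m W tab thr r s) (hr : 0 < r)
    (hne : (goodWords m W thr).Nonempty) :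
    Ev B enumProg s (m * (levelTime m r + 2) + 7) (fun s' => EnumCtx m W tab thr r s' ∧
      ∃ lo E, LevelInv (goodWords m W thr) r 0 E ∧ EntRel m W s' lo E ∧
      lo + E.length < 2 ^ B ∧ s'.reg 40 = lo ∧ s'.reg 41 = lo + E.length) := by
  have h1B : 1 < 2 ^ B := by have := hb.tot; omega
  have hKm : ∀ w ∈ goodWords m W thr, w.length = m ∧ ∀ c ∈ w, c < m := by
    rintro w ⟨hw, -⟩
    exact ⟨by rw [← hw.card, card_range], hw.nodup.2.2⟩
  have hinit : LevelInv (goodWords m W thr) r m [[]] :=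
    LevelInv.init hr (hne.imp fun w hw => ⟨hw, (hKm w hw).1⟩) fun w hw => (hKm w hw).1
  have hfull : s.arr 3 m - 1 = mask (range m) := by rw [hs.pow m le_rfl, mask_range]
  refine Ev.le (Ev.storeSeq hb.pos (by decide) (fun hg => ?_)
    (Ev.storeSeq hb.pos (by decide) (fun _ => by simp [Expr.eval])
    (Ev.storeSeq hb.pos (by decide) (fun _ => by simp [Expr.eval])
    (Ev.setSeq hb.pos (by decide) (fun _ => by simp [Expr.eval])
    (Ev.setSeq (T := m * (levelTime m r + 2) + 2) hb.pos (by decide)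
      (fun _ => by simpa [Expr.eval] using h1B) ?_))))) (by omega)
  · have := hg.arr 3 (s.reg 0)
    simp only [Expr.eval, BinOp.eval]; omega
  refine (Ev.forLoop m ?_ hb.pos (by decide) (by decide) (by decide)
    -- After `k` rounds `m - k` letters are missing. The levels stand one behind the other, the
    -- initial one having one entry and the others at most `r`, whence the bound `k * r + 1` on the
    -- addresses.
    (fun k s' => EnumCtx m W tab thr r s' ∧
      ∃ lo E, LevelInv (goodWords m W thr) r (m - k) E ∧ EntRel m W s' lo E ∧
      lo + E.length ≤ k * r + 1 ∧ s'.reg 40 = lo ∧ s'.reg 41 = lo + E.length)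
    ?_ ?_).mono le_rfl ?_
  · simpa using hs.reg
  · refine ⟨hs.congr (fun x hx => ?_) (fun a h2 h4 => ?_), 0, [[]], hinit, ⟨?_, ?_, ?_⟩, by simp,
      by simp [Expr.eval], by simp [Expr.eval]⟩
    · interval_cases x <;> simp
    · funext j
      simp only [State.setReg_arr, State.setArr_arr]
      rw [if_neg (by omega), if_neg (by omega), if_neg (by omega)]
    · intro j hj
      obtain rfl : j = 0 := by simpa using hj
      simp [Expr.eval, BinOp.eval, hs.reg, hfull]
    · intro j hj
      obtain rfl : j = 0 := by simpa using hj
      simp [Expr.eval, gainSum]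
    · intro j hj
      obtain rfl : j = 0 := by simpa using hj
      simp [Expr.eval]
  · rintro k hk s₁ - - - ⟨hs₁, lo, E, hinv, hE, hlen, h40, h41⟩
    have hkr : k * r + r ≤ m * r := by
      have := Nat.mul_le_mul_right r (show k + 1 ≤ m from hk)
      linarith
    have hmr : (m + 1) * (r + 1) = m * r + m + r + 1 := by ring
    have := hb.list
    have hinv' : LevelInv (goodWords m W thr) r ((m - (k + 1)) + 1) E := by
      rwa [show m - (k + 1) + 1 = m - k by omega]
    have hnext := hinv'.next hKm (by omega)
    refine (ev_levelProg hb ht hs₁ hE hinv.length_le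
      (fun l hl => (hinv.suffix l hl).imp fun u hu => hu.2) (by omega) h40 h41).mono le_rfl ?_
    rintro s₂ ⟨hs₂, hE₂, h40', h41'⟩
    refine ⟨hs₂.congr (fun x hx => ?_) (fun _ _ _ => rfl), _, _, hnext,
      hE₂.congr (fun _ _ _ => rfl), ?_, by simpa using h40', by simpa using h41'⟩
    · interval_cases x <;> simp
    · have := hnext.length_le
      rw [add_mul]; omega
  · rintro s₁ ⟨-, hs₁, lo, E, hinv, hE, hlen, h40, h41⟩
    rw [Nat.sub_self] at hinv
    have hmr : (m + 1) * (r + 1) = m * r + m + r + 1 := by ring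
    have := hb.list
    exact ⟨hs₁, lo, E, hinv, hE, by omega, h40, h41⟩

theorem getElem?_flatten {m : ℕ} {E : List (List ℕ)} (hE : ∀ l ∈ E, l.length = m) {j p : ℕ}
    (hj : j < E.length) (hp : p < m) : E.flatten[j * m + p]? = E[j][p]? := by
  induction E generalizing j with
  | nil => simp at hj
  | cons l E ih =>
    have hl := hE l (by simp)
    cases j with
    | zero => simp [List.getElem?_append, hl, hp]
    | succ j =>
      rw [List.flatten_cons, List.getElem?_append_right (by rw [hl, add_mul]; omega), hl,
        show (j + 1) * m + p - m = j * m + p by rw [add_mul]; omega]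
      exact ih (fun l' hl' => hE l' (by simp [hl'])) (by simpa using hj)

/-- The first letter of a word is the lowest base-`m` digit of its code, so repeated division by `m`
yields the letters in the order of output. -/
theorem ev_outputProg {B m n r : ℕ} (hb : Bounds B m n r) {W : ℕ → ℕ → ℕ} {s : State}
    (h0 : s.reg 0 = m) {lo : ℕ} {E : List (List ℕ)} (hE : EntRel m W s lo E)
    (hEm : ∀ l ∈ E, l.length = m ∧ ∀ c ∈ l, c < m) (hEr : E.length ≤ r)
    (hlo : lo + E.length < 2 ^ B) (h40 : s.reg 40 = lo) (h41 : s.reg 41 = lo + E.length) :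
    Ev B outputProg s (r * (m * 4 + 5) + 4) (fun s' => s'.Outputs (E.length :: E.flatten)) := by
  refine Ev.le (Ev.setSeq hb.pos (by decide) (fun _ => ?_)
    (Ev.storeSeq (T := E.length * ((1 + (m * ((1 + 1) + 2) + 2)) + 2) + 2) hb.pos (by decide)
      (fun hg => by simpa [Expr.eval] using hg.reg 44) ?_)) ?_
  · simp [Expr.eval, BinOp.eval, h40, h41]; omega
  swap
  · have := Nat.mul_le_mul_right (m * 4 + 5) hEr
    have e : (1 + (m * ((1 + 1) + 2) + 2)) + 2 = m * 4 + 5 := by ring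
    rw [e]; omega
  refine (Ev.forLoop E.length ?_ hb.pos (by decide) (by decide) (by decide)
    (fun i s' => s'.arr 1 0 = E.length ∧ ∀ j (h : j < E.length), j < i → ∀ p < m,
      E[j][p]? = some (s'.arr 1 (1 + (j * m + p)))) ?_ ?_).mono le_rfl ?_
  · simp [Expr.eval, BinOp.eval, h40, h41]
  · simp [Expr.eval, BinOp.eval, h40, h41]
  · rintro i hi s₁ F h45 - ⟨h1, h2⟩
    have a0 : s₁.reg 0 = m := by rw [F.reg 0 (by decide)]; simp [h0]
    have a40 : s₁.reg 40 = lo := by rw [F.reg 40 (by decide)]; simp [h40]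
    have a8 : s₁.arr 8 (lo + i) = Nat.ofDigits m E[i] := by
      rw [F.arr 8 (by decide)]; simpa [Expr.eval] using hE.code i hi
    have hw := hEm _ (List.getElem_mem hi)
    refine Ev.setSeq hb.pos (by decide) (fun hg => by simpa [Expr.eval] using hg.arr 8 _) ?_
    refine (Ev.forLoop m ?_ hb.pos (by decide) (by decide) (by decide)
      (fun q s' => s'.arr 1 0 = E.length ∧ (∀ j (h : j < E.length), j < i → ∀ p < m,
        E[j][p]? = some (s'.arr 1 (1 + (j * m + p)))) ∧
        (∀ p < q, E[i][p]? = some (s'.arr 1 (1 + (i * m + p)))) ∧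
        s'.reg 47 = Nat.ofDigits m (E[i].drop q)) ?_ ?_).mono le_rfl ?_
    · simpa using a0
    · refine ⟨h1, h2, by simp, ?_⟩
      simp [Expr.eval, BinOp.eval, a40, h45, a8]
    · rintro q hq s₂ F₂ h21 hm ⟨c1, c2, c3, c4⟩
      have b45 : s₂.reg 45 = i := by rw [F₂.reg 45 (by decide)]; simpa using h45
      have hqlen : q < E[i].length := by rw [hw.1]; exact hq
      have hcm : E[i][q] < m := hw.2 _ (List.getElem_mem hqlen)
      rw [List.drop_eq_getElem_cons hqlen, Nat.ofDigits_cons] at c4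
      have hdiv : (E[i][q] + m * Nat.ofDigits m (E[i].drop (q + 1))) / m =
          Nat.ofDigits m (E[i].drop (q + 1)) := by
        rw [Nat.add_mul_div_left _ _ (by omega), Nat.div_eq_of_lt hcm, zero_add]
      have hval : (Expr.bin .sub (.reg 47) (.bin .mul (.reg 0)
          (.bin .div (.reg 47) (.reg 0)))).eval s₂ = E[i][q] := by
        simp only [Expr.eval, BinOp.eval, c4, hm]
        rw [hdiv]; omega
      refine Ev.storeSeq (T := 1) hb.pos (by decide) (fun hg => ?_)
        (Ev.set hb.pos (by decide) (fun hg => ?_) ?_)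
      · have := hg.reg 47
        simp only [Expr.eval, BinOp.eval]; omega
      · exact (Nat.div_le_self _ _).trans_lt (hg.reg 47)
      -- Distinct pairs of word and position have distinct addresses, so earlier output is not
      -- overwritten.
      · have haddr : ∀ j p, p < m → (j < i ∨ j = i ∧ p < q) → j * m + p ≠ i * m + q := by
          rintro j p hp (h | ⟨rfl, h⟩)
          · have := Nat.mul_le_mul_right m (show j + 1 ≤ i from h)
            rw [add_mul] at this
            omega
          · omega
        simp only [State.setReg_arr, State.setArr_arr, State.setReg_reg, State.setArr_reg,
          true_and, hval]
        simp only [Expr.eval, BinOp.eval, b45, hm, h21, State.setArr_reg]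
        refine ⟨?_, ?_, ?_, ?_⟩
        · rw [if_neg (by omega), c1]
        · intro j hj hji p hp
          have := haddr j p hp (Or.inl hji)
          rw [if_neg (by omega)]
          exact c2 j hj hji p hp
        · intro p hp
          by_cases e : p = q
          · subst e
            rw [if_pos rfl, List.getElem?_eq_getElem hqlen]
          · have := haddr i p (by omega) (Or.inr ⟨rfl, by omega⟩)
            rw [if_neg (by omega)]
            exact c3 p (by omega)
        · simp only [c4]
          rw [if_neg (by decide), if_pos trivial]
          exact hdiv
    · rintro s₂ ⟨-, c1, c2, c3, -⟩
      refine ⟨by simpa using c1, fun j hj hji p hp => ?_⟩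
      rcases Nat.lt_succ_iff_lt_or_eq.1 hji with h | rfl
      · simpa using c2 j hj h p hp
      · simpa using c3 p hp
  · rintro s₁ ⟨-, h1, h2⟩ q hq
    cases q with
    | zero => simpa using h1
    | succ q =>
      have hq' : q < E.flatten.length := by simpa using hq
      have hlen : E.flatten.length = E.length * m := by
        rw [List.length_flatten, List.map_congr_left (g := fun _ => m) fun l hl => (hEm l hl).1]
        simp
      rw [hlen] at hq'
      have hm : 0 < m := by
        rcases Nat.eq_zero_or_pos m with rfl | h
        · simp at hq'
        · exact h
      have hj : q / m < E.length := Nat.div_lt_of_lt_mul (by rwa [mul_comm])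
      have hp := Nat.mod_lt q hm
      have e : q / m * m + q % m = q := by
        rw [mul_comm]; exact Nat.div_add_mod q m
      have h3 := h2 _ hj hj _ hp
      rw [← getElem?_flatten (fun l hl => (hEm l hl).1) hj hp, e] at h3
      rw [List.getElem_cons_succ, add_comm q 1]
      rw [List.getElem?_eq_getElem (by rw [hlen]; exact hq')] at h3
      exact (Option.some.inj h3).symm

/-- The candidate at the position in register `p` in the vote `12`. -/
def voteAt (p : ℕ) : Expr := .load 0 (.const 5 +ₑ (.reg 12 *ₑ .reg 0 +ₑ .reg p))

/-- The pairwise majorities. -/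
def majProg : Prog :=
  forLoop 10 0 (forLoop 11 10 (forLoop 12 1 (.store 2 (voteAt 11 *ₑ .reg 0 +ₑ voteAt 10)
    (.load 2 (voteAt 11 *ₑ .reg 0 +ₑ voteAt 10) +ₑ .const 1))))

/-- The least gain of a ranking that is to be listed. -/
def thresholdProg : Prog :=
  .set 50 (.reg 1 *ₑ (.reg 0 *ₑ (.reg 0 -ₑ .const 1) /ₑ .const 2)) ;;
  .set 51 (.load 4 (.load 3 (.reg 0) -ₑ .const 1) -ₑ .const 1) ;;
  .set 3 (.reg 50 -ₑ .load 0 (.const 3) *ₑ (.reg 50 -ₑ .reg 51) /ₑ .load 0 (.const 4))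

/-! ### Correctness and time of the majorities and the threshold -/

theorem ev_majProg {B m n r : ℕ} (hb : Bounds B m n r) {s : State} (h0 : s.reg 0 = m)
    (h1 : s.reg 1 = n) {w : ℕ → ℕ → ℕ} (hw : ∀ i < n, ∀ p < m, w i p < m)
    (hin : ∀ i < n, ∀ p < m, s.arr 0 (5 + (i * m + p)) = w i p) (h2 : ∀ x, s.arr 2 x = 0) :
    Ev B majProg s (m * (m * (n * 3 + 4) + 4) + 2) (fun s' => ∀ a < m, ∀ b < m,
      s'.arr 2 (a * m + b) =
        ∑ p ∈ range m, ∑ q ∈ range p, ∑ i ∈ range n, if w i q = a ∧ w i p = b then 1 else 0) := by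
  set f : ℕ → ℕ → ℕ → ℕ → ℕ → ℕ := fun a b p q i => if w i q = a ∧ w i p = b then 1 else 0 with hf
  refine Ev.le (T := m * ((m * (n * 3 + 4) + 2) + 2) + 2) ?_ le_rfl
  refine (Ev.forLoop m ?_ hb.pos (by decide) (by decide) (by decide)
    -- The second clause bounds every cell by a bound on the number of increments made so far; it
    -- keeps the cells below `2 ^ B`.
    (fun P s' => (∀ a < m, ∀ b < m, s'.arr 2 (a * m + b) =
      ∑ p ∈ range P, ∑ q ∈ range p, ∑ i ∈ range n, f a b p q i) ∧
      ∀ x, s'.arr 2 x ≤ P * m * n) ?_ ?_).mono le_rfl fun s' h => h.2.1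
  · exact h0
  · simp [h2]
  rintro P hP s₁ F h10 hm ⟨hv, hle⟩
  refine Ev.le (T := P * ((n * 3 + 2) + 2) + 2) ?_ ?_
  swap
  · have := Nat.mul_le_mul_right (n * 3 + 4) hP.le
    rw [show n * 3 + 2 + 2 = n * 3 + 4 by ring]; omega
  refine (Ev.forLoop P h10 hb.pos (by decide) (by decide) (by decide)
    (fun Q s' => (∀ a < m, ∀ b < m, s'.arr 2 (a * m + b) =
      ∑ p ∈ range P, ∑ q ∈ range p, ∑ i ∈ range n, f a b p q i +
        ∑ q ∈ range Q, ∑ i ∈ range n, f a b P q i) ∧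
      ∀ x, s'.arr 2 x ≤ (P * m + Q) * n) ?_ ?_).mono le_rfl ?_
  · exact ⟨by simpa using hv, by simpa using hle⟩
  swap
  · rintro s₂ ⟨-, hv₂, hle₂⟩
    refine ⟨?_, fun x => (hle₂ x).trans ?_⟩
    · simpa [sum_range_succ] using hv₂
    · refine Nat.mul_le_mul_right _ ?_
      rw [add_mul]; omega
  rintro Q hQ s₂ F₂ h11 hP' ⟨hv₂, hle₂⟩
  refine (Ev.forLoop (T := 1) n ?_ hb.pos (by decide) (by decide) (by decide)
    (fun I s' => (∀ a < m, ∀ b < m, s'.arr 2 (a * m + b) =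
      ∑ p ∈ range P, ∑ q ∈ range p, ∑ i ∈ range n, f a b p q i +
        ∑ q ∈ range Q, ∑ i ∈ range n, f a b P q i + ∑ i ∈ range I, f a b P Q i) ∧
      ∀ x, s'.arr 2 x ≤ (P * m + Q) * n + I) ?_ ?_).mono le_rfl ?_
  · rw [F₂.reg 1 (by decide), F.reg 1 (by decide), h1]
  · exact ⟨by simpa using hv₂, by simpa using hle₂⟩
  swap
  · rintro s₃ ⟨-, hv₃, hle₃⟩
    refine ⟨?_, fun x => (hle₃ x).trans (le_of_eq (by ring))⟩
    intro a ha b hb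
    simp only [State.setReg_arr, sum_range_succ, hv₃ a ha b hb]
    ring
  rintro I hI s₃ F₃ h12 hn ⟨hv₃, hle₃⟩
  have b0 : s₃.reg 0 = m := by
    rw [F₃.reg 0 (by decide), F₂.reg 0 (by decide), F.reg 0 (by decide), h0]
  have b10 : s₃.reg 10 = P := by rw [F₃.reg 10 (by decide), hP']
  have b11 : s₃.reg 11 = Q := by rw [F₃.reg 11 (by decide), h11]
  have bin : ∀ p < m, s₃.arr 0 (5 + (I * m + p)) = w I p := by
    intro p hp
    rw [F₃.arr 0 (by decide), F₂.arr 0 (by decide), F.arr 0 (by decide), hin I hI p hp]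
  have eP : (voteAt 10).eval s₃ = w I P := by
    simp only [voteAt, Expr.eval, BinOp.eval, h12, b0, b10, bin P hP]
  have eQ : (voteAt 11).eval s₃ = w I Q := by
    simp only [voteAt, Expr.eval, BinOp.eval, h12, b0, b11, bin Q (hQ.trans hP)]
  refine Ev.store hb.pos (by decide) (fun _ => ?_) ⟨?_, ?_⟩
  · have h3 := hle₃ (w I Q * m + w I P)
    simp only [Expr.eval, BinOp.eval, eP, eQ, b0]
    have h4 : (P * m + Q) * n + n ≤ n * m * m := by
      have h5 : (P + 1) * m * n ≤ m * m * n :=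
        Nat.mul_le_mul_right _ (Nat.mul_le_mul_right _ hP)
      have h6 : (P * m + Q + 1) * n ≤ (P + 1) * m * n :=
        Nat.mul_le_mul_right _ (by rw [add_mul]; omega)
      have h7 : m * m * n = n * m * m := by ring
      rw [add_mul (P * m + Q)] at h6
      omega
    have := hb.tot
    omega
  · intro a ha b hb'
    have hQm := hw I hI Q (hQ.trans hP)
    have hPm := hw I hI P hP
    -- Quotient and remainder by `m` recover the pair from its address.
    have hinj : a * m + b = w I Q * m + w I P ↔ w I Q = a ∧ w I P = b := by
      constructor
      · intro h
        have h3 := congrArg (· / m) h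
        have h4 := congrArg (· % m) h
        have hm : 0 < m := by omega
        simp only [mul_comm _ m, Nat.mul_add_div hm, Nat.div_eq_of_lt hb', Nat.div_eq_of_lt hPm,
          Nat.mul_add_mod, Nat.mod_eq_of_lt hb', Nat.mod_eq_of_lt hPm, add_zero] at h3 h4
        exact ⟨h3.symm, h4.symm⟩
      · rintro ⟨rfl, rfl⟩; rfl
    simp only [State.setReg_arr, State.setArr_arr, true_and, Expr.eval, BinOp.eval, eP, eQ, b0,
      hinj, sum_range_succ]
    by_cases h : w I Q = a ∧ w I P = b
    · rw [if_pos h]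
      have := hv₃ a ha b hb'
      rw [← h.1, ← h.2] at this ⊢
      rw [this]
      simp [hf, add_assoc]
    · rw [if_neg h, hv₃ a ha b hb']
      simp [hf, h]
  · intro x
    simp only [State.setReg_arr, State.setArr_arr, true_and, Expr.eval, BinOp.eval, eP, eQ, b0]
    split_ifs
    · have := hle₃ (w I Q * m + w I P); omega
    · have := hle₃ x; omega

theorem ev_thresholdProg {B m n r : ℕ} (hb : Bounds B m n r) {W : ℕ → ℕ → ℕ} {s : State}
    (hs : Ctx m W s) (h1 : s.reg 1 = n) :
    Ev B thresholdProg s 3 (fun s' => s'.reg 3 = n * (m * (m - 1) / 2) -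
      s.arr 0 3 * (n * (m * (m - 1) / 2) - (s.arr 4 (mask (range m)) - 1)) / s.arr 0 4) := by
  have htot : n * (m * (m - 1) / 2) ≤ n * m * m := by
    rw [mul_assoc]
    exact Nat.mul_le_mul_left _ ((Nat.div_le_self _ _).trans
      (Nat.mul_le_mul_left _ (Nat.sub_le _ _)))
  have := hb.tot
  refine Ev.setSeq hb.pos (by decide) (fun _ => ?_) (Ev.setSeq (T := 1) hb.pos (by decide)
    (fun hg => ?_) (Ev.set hb.pos (by decide) (fun hg => ?_) ?_))
  · simp only [Expr.eval, BinOp.eval, hs.reg, h1]; omega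
  · exact (Nat.sub_le _ _).trans_lt (hg.arr 4 _)
  -- Only the final difference is stored; the product with the numerator of the approximation factor
  -- needs no bound here.
  · exact (Nat.sub_le _ _).trans_lt (hg.reg 50)
  · simp [Expr.eval, BinOp.eval, hs.reg, h1, hs.pow m le_rfl, mask_range]

variable {m n : ℕ}

/-! ### Pairwise majorities -/

/-- The number of votes that prefer `a` to `b`. -/
noncomputable def wt (R : Profile m n) (a b : ℕ) : ℕ :=
  #{i : Fin n | ∃ (ha : a < m) (hb : b < m), R i ⟨a, ha⟩ < R i ⟨b, hb⟩}

theorem wt_le (R : Profile m n) (a b : ℕ) : wt R a b ≤ n :=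
  (card_le_univ _).trans (by simp)

theorem wt_coe (R : Profile m n) (a b : Fin m) :
    wt R a b = ∑ i, if R i a < R i b then 1 else 0 := by
  rw [wt, card_filter]
  simp

theorem wt_eq_zero_iff (R : Profile m n) {a b : Fin m} (hab : a ≠ b) :
    wt R a b = 0 ↔ Unanimous R b a := by
  rw [wt_coe]
  simp only [sum_eq_zero_iff, mem_univ, ite_eq_right_iff, one_ne_zero, imp_false, not_lt,
    forall_const, Unanimous, Prefers]
  refine forall_congr' fun i => ⟨fun h => lt_of_le_of_ne h ?_, le_of_lt⟩
  exact fun e => hab ((R i).injective e).symm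

/-- The candidate at position `p` of the vote `i`. -/
def voteEntry (R : Profile m n) (i p : ℕ) : ℕ :=
  if h : i < n ∧ p < m then (R ⟨i, h.1⟩).symm ⟨p, h.2⟩ else 0

theorem voteEntry_lt (R : Profile m n) {i p : ℕ} (hi : i < n) (hp : p < m) :
    voteEntry R i p < m := by
  simp [voteEntry, hi, hp]

theorem voteEntry_eq_iff (R : Profile m n) {i p a : ℕ} (hi : i < n) (hp : p < m) (ha : a < m) :
    voteEntry R i p = a ↔ p = R ⟨i, hi⟩ ⟨a, ha⟩ := by
  have : voteEntry R i p = ((R ⟨i, hi⟩).symm ⟨p, hp⟩ : ℕ) := by simp [voteEntry, hi, hp]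
  rw [this]
  refine Iff.trans (Fin.ext_iff (b := ⟨a, ha⟩)).symm ?_
  rw [Equiv.symm_apply_eq, Fin.ext_iff]

/-- In each vote `a` and `b` occur at one position each, so the double sum has at most one term,
present when `a` comes first. -/
theorem sum_voteEntry (R : Profile m n) {a b : ℕ} (ha : a < m) (hb : b < m) :
    (∑ p ∈ range m, ∑ q ∈ range p, ∑ i ∈ range n,
      if voteEntry R i q = a ∧ voteEntry R i p = b then 1 else 0) = wt R a b := by
  have h1 : wt R a b = ∑ i : Fin n, if R i ⟨a, ha⟩ < R i ⟨b, hb⟩ then 1 else 0 :=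
    wt_coe R ⟨a, ha⟩ ⟨b, hb⟩
  have h2 : ∀ p, (∑ q ∈ range p, ∑ i ∈ range n,
      if voteEntry R i q = a ∧ voteEntry R i p = b then 1 else 0) = ∑ i ∈ range n, ∑ q ∈ range p,
      if voteEntry R i q = a ∧ voteEntry R i p = b then 1 else 0 := fun p => sum_comm
  rw [h1]
  simp only [h2]
  rw [sum_comm, ← Fin.sum_univ_eq_sum_range (n := n) (fun i => ∑ p ∈ range m, ∑ q ∈ range p,
      if voteEntry R i q = a ∧ voteEntry R i p = b then 1 else 0)]
  refine sum_congr rfl fun i _ => ?_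
  set x := R i ⟨a, ha⟩
  set y := R i ⟨b, hb⟩
  have h3 : ∀ p ∈ range m, ∀ q ∈ range p,
      (if voteEntry R i q = a ∧ voteEntry R i p = b then 1 else 0) =
        if (x : ℕ) = q then (if (y : ℕ) = p then 1 else 0) else 0 := by
    intro p hp q hq
    rw [mem_range] at hp hq
    rw [← ite_and]
    refine if_congr (and_congr ?_ ?_) rfl rfl
    · rw [voteEntry_eq_iff R i.2 (hq.trans hp) ha, eq_comm]
    · rw [voteEntry_eq_iff R i.2 hp hb, eq_comm]
  rw [sum_congr rfl fun p hp => sum_congr rfl (h3 p hp)]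
  simp only [sum_ite_eq, mem_range]
  rw [sum_congr rfl (g := fun p => if (y : ℕ) = p then (if (x : ℕ) < p then 1 else 0) else 0)
    fun p _ => by split_ifs <;> rfl]
  simp

/-! ### Rankings as words -/

theorem gainSum_ofFn {W : ℕ → ℕ → ℕ} {k : ℕ} {D : Finset ℕ} (f : Fin k → ℕ)
    (hf : Function.Injective f) (hD : ∀ p, f p ∉ D) :
    gainSum W D (List.ofFn f) =
      ∑ p, (gain W D (f p) + ∑ q, if q < p then W (f q) (f p) else 0) := by
  induction k generalizing D with
  | zero => simp [gainSum]
  | succ k ih =>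
    rw [List.ofFn_succ, gainSum, ih (fun p => f p.succ)
      (hf.comp (Fin.succ_injective _)), Fin.sum_univ_succ]
    · congr 1
      · simp
      · refine sum_congr rfl fun p _ => ?_
        rw [Fin.sum_univ_succ, gain, sum_insert (hD 0)]
        simp only [Fin.succ_pos, if_true, Fin.succ_lt_succ_iff, gain]
        ring
    · intro p
      rw [mem_insert, not_or]
      exact ⟨fun e => Fin.succ_ne_zero p (hf e), hD _⟩

theorem path_ofFn {W : ℕ → ℕ → ℕ} {k : ℕ} {D : Finset ℕ} (f : Fin k → ℕ)
    (hf : Function.Injective f) (hD : ∀ p, f p ∉ D) (hm : ∀ p, f p < m) :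
    Path m W D (List.ofFn f) (D ∪ univ.image f) ↔
      ∀ p, ∀ a < m, a ∉ D → (∀ q < p, a ≠ f q) → a ≠ f p → W (f p) a ≠ 0 := by
  induction k generalizing D with
  | zero => simp [Path]
  | succ k ih =>
    have e : D ∪ univ.image f = insert (f 0) D ∪ univ.image fun p : Fin k => f p.succ := by
      ext a
      simp only [mem_union, mem_image, mem_univ, true_and, mem_insert, Fin.exists_fin_succ]
      rw [eq_comm (a := a)]
      tauto
    rw [List.ofFn_succ, Path, e, ih (fun p => f p.succ) (hf.comp (Fin.succ_injective _))
      (fun p => by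
        rw [mem_insert, not_or]
        exact ⟨fun e => Fin.succ_ne_zero p (hf e), hD _⟩) (fun p => hm _), Fin.forall_fin_succ]
    refine and_congr ?_ (forall_congr' fun p => forall_congr' fun a => forall_congr' fun _ => ?_)
    · simp [Ok, hD, hm]
    · simp only [mem_insert, not_or, Fin.forall_fin_succ, Fin.succ_pos, forall_const,
        Fin.succ_lt_succ_iff]
      tauto

theorem toWord_injective : Function.Injective (Ranking.toWord (m := m)) := by
  intro π σ h
  have h1 := List.ofFn_injective h
  have : π.symm = σ.symm := by
    ext p
    exact congrFun h1 p
  simpa using congrArg Equiv.symm this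

/-- Admissibility at every position says that no candidate still to come is unanimously preferred to
the one placed there. -/
theorem path_toWord (hn : 0 < n) (R : Profile m n) (π : Ranking m) :
    Path m (wt R) ∅ (Ranking.toWord π) (range m) ↔ RespectsUnanimity R π := by
  have hinj : Function.Injective fun p : Fin m => (π.symm p : ℕ) :=
    Fin.val_injective.comp π.symm.injective
  have key := path_ofFn (m := m) (W := wt R) (D := ∅) (fun p : Fin m => (π.symm p : ℕ)) hinj
    (by simp) (by simp)
  have himg : (∅ : Finset ℕ) ∪ univ.image (fun p : Fin m => (π.symm p : ℕ)) = range m := by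
    ext a
    simp only [empty_union, mem_image, mem_univ, true_and, mem_range]
    constructor
    · rintro ⟨p, rfl⟩; exact (π.symm p).2
    · intro ha
      exact ⟨π ⟨a, ha⟩, by simp⟩
  rw [himg] at key
  rw [Ranking.toWord, key]
  constructor
  · intro h a b hab
    by_contra hlt
    have hne : b ≠ a := by
      rintro rfl
      exact lt_irrefl _ (hab ⟨0, hn⟩)
    -- Admissibility fails where `b` is placed: its unanimous predecessor `a` has not yet appeared.
    refine h (π b) a a.2 (by simp) ?_ ?_ ?_
    · intro q hq e
      have : a = π.symm q := Fin.ext e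
      subst this
      exact hlt (by simpa [Prefers] using hq)
    · rw [Equiv.symm_apply_apply]
      exact fun e => hne (Fin.ext e).symm
    · rw [Equiv.symm_apply_apply]
      exact (wt_eq_zero_iff R hne).2 hab
  · intro h p a ha _ hq hp h0
    have hne : π.symm p ≠ ⟨a, ha⟩ := fun e => hp (by rw [e])
    have := h _ _ ((wt_eq_zero_iff R hne).1 h0)
    rw [Prefers, Equiv.apply_symm_apply] at this
    exact hq _ this (by simp)

theorem exists_toWord {W : ℕ → ℕ → ℕ} {w : List ℕ} (h : Path m W ∅ w (range m)) :
    ∃ π : Ranking m, Ranking.toWord π = w := by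
  obtain ⟨hnd, -, hlt⟩ := h.nodup
  have hlen : w.length = m := by rw [← h.card, card_range]
  subst hlen
  let f : Fin w.length → Fin w.length := fun p => ⟨w[p], hlt _ (List.getElem_mem _)⟩
  have hf : Function.Injective f := by
    intro p q e
    have : w[p] = w[q] := congrArg Fin.val e
    exact Fin.ext ((hnd.getElem_inj_iff).1 this)
  refine ⟨(Equiv.ofBijective f (Finite.injective_iff_bijective.1 hf)).symm, ?_⟩
  simp [Ranking.toWord, f]

theorem sum_lt_eq (π : Ranking m) :
    (∑ a, ∑ b, if π a < π b then 1 else 0) = m * (m - 1) / 2 := by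
  rw [Equiv.sum_comp π fun x => ∑ b, if x < π b then 1 else 0]
  have : ∀ x : Fin m, (∑ b, if x < π b then 1 else 0) = ∑ y, if x < y then 1 else 0 :=
    fun x => Equiv.sum_comp π fun y => if x < y then 1 else 0
  simp only [this]
  rw [sum_comm, ← sum_range_id, ← Fin.sum_univ_eq_sum_range (fun i => i)]
  refine sum_congr rfl fun y _ => ?_
  rw [← card_filter, ← Fin.card_Iio]
  congr 1
  ext; simp

theorem gainSum_toWord (R : Profile m n) (π : Ranking m) :
    gainSum (wt R) ∅ (Ranking.toWord π) =
      ∑ i, ∑ a, ∑ b, if π a < π b ∧ R i a < R i b then 1 else 0 := by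
  have hinj : Function.Injective fun p : Fin m => (π.symm p : ℕ) :=
    Fin.val_injective.comp π.symm.injective
  rw [Ranking.toWord, gainSum_ofFn _ hinj (by simp)]
  simp only [gain, sum_empty, zero_add]
  rw [← Equiv.sum_comp π fun p => ∑ q, if q < p then wt R (π.symm q) (π.symm p) else 0]
  simp only [Equiv.symm_apply_apply]
  have : ∀ b : Fin m, (∑ q, if q < π b then wt R (π.symm q) b else 0) =
      ∑ a : Fin m, if π a < π b then wt R a b else 0 := by
    intro b
    rw [← Equiv.sum_comp π fun q => if q < π b then wt R (π.symm q) b else 0]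
    simp
  rw [sum_congr rfl fun b _ => this b]
  simp only [wt_coe]
  have h2 : ∀ a b : Fin m, (if π a < π b then ∑ i, (if R i a < R i b then 1 else 0) else 0) =
      ∑ i, if π a < π b ∧ R i a < R i b then 1 else 0 := by
    intro a b
    split_ifs with h <;> simp [h]
  simp only [h2]
  rw [sum_comm]
  rw [sum_congr rfl fun a _ => sum_comm (s := univ) (t := univ)]
  rw [sum_comm]

/-- For a fixed vote, each pair ordered by `π` is either an agreement, counted in the gain, or a
disagreement, counted in the score. -/
theorem gainSum_add_score (R : Profile m n) (π : Ranking m) :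
    gainSum (wt R) ∅ (Ranking.toWord π) + score R π = n * (m * (m - 1) / 2) := by
  rw [gainSum_toWord, score, ← sum_add_distrib]
  rw [sum_congr rfl (g := fun _ => m * (m - 1) / 2)]
  · simp
  intro i _
  rw [ktDist, card_filter, ← univ_product_univ, sum_product, ← sum_add_distrib, ← sum_lt_eq π]
  refine sum_congr rfl fun a _ => ?_
  rw [← sum_add_distrib]
  refine sum_congr rfl fun b _ => ?_
  by_cases h : π a < π b
  · have hne : R i a ≠ R i b := fun e => h.ne (congrArg π ((R i).injective e))
    rcases lt_or_gt_of_ne hne with h1 | h1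
    · simp [h, h1, h1.le]
    · simp [h, h1, h1.le]
  · simp [h]

/-! ### Optimal rankings respect the unanimity order -/

/-- The disagreements after the swap inject into those before it, missing `(b, a)`: a pair that was
a disagreement already stays, any other is moved by the swap. The pairs really moved are of the form
`(a, y)` or `(x, b)`, and there `σ a < σ b` shows that the image is a disagreement of `π`. -/
theorem ktDist_swap_lt {π σ : Ranking m} {a b : Fin m} (hσ : σ a < σ b) (hπ : π b < π a) :
    ktDist ((Equiv.swap a b).trans π) σ < ktDist π σ := by
  have hab : a ≠ b := by rintro rfl; exact lt_irrefl _ hσ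
  set τ := Equiv.swap a b with hτ
  unfold ktDist
  set A := univ.filter fun q : Fin m × Fin m =>
    Prefers (τ.trans π) q.1 q.2 ∧ Prefers σ q.2 q.1 with hA
  set C := univ.filter fun q : Fin m × Fin m => Prefers π q.1 q.2 ∧ Prefers σ q.2 q.1 with hC
  have hba : (b, a) ∈ C := by simp [hC, Prefers, hπ, hσ]
  have hττ : ∀ x, τ (τ x) = x := fun x => Equiv.swap_apply_self a b x
  let φ : Fin m × Fin m → Fin m × Fin m := fun q => if q ∈ C then q else (τ q.1, τ q.2)
  refine lt_of_le_of_lt (card_le_card_of_injOn (t := C.erase (b, a)) φ ?_ ?_)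
    (card_erase_lt_of_mem hba)
  · rintro ⟨x, y⟩ hq
    have hq' : π (τ x) < π (τ y) ∧ σ y < σ x := (mem_filter.1 (mem_coe.1 hq)).2
    obtain ⟨h1, h2⟩ := hq'
    by_cases hc : (x, y) ∈ C
    · simp only [φ, if_pos hc, coe_erase, Set.mem_sdiff, Set.mem_singleton_iff, mem_coe]
      refine ⟨hc, ?_⟩
      rintro ⟨⟩
      simp only [hτ, Equiv.swap_apply_left, Equiv.swap_apply_right] at h1
      exact absurd h1 hπ.asymm
    · simp only [φ, if_neg hc, coe_erase, Set.mem_sdiff, Set.mem_singleton_iff, mem_coe]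
      have hc' : ¬ π x < π y := fun h => hc (by simp [hC, Prefers, h, h2])
      constructor
      · simp only [hC, Prefers, mem_filter, mem_univ, true_and]
        refine ⟨h1, ?_⟩
        by_cases hxa : x = a
        · subst hxa
          by_cases hyb : y = b
          · subst hyb; exact absurd h2 hσ.asymm
          · have hyx : y ≠ x := by rintro rfl; exact lt_irrefl _ h2
            rw [hτ, Equiv.swap_apply_left, Equiv.swap_apply_of_ne_of_ne hyx hyb]
            exact h2.trans hσ
        by_cases hxb : x = b
        · subst hxb
          by_cases hya : y = a
          · subst hya
            simp only [hτ, Equiv.swap_apply_left, Equiv.swap_apply_right] at h1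
            exact absurd h1 hπ.asymm
          · have hyx : y ≠ x := by rintro rfl; exact lt_irrefl _ h2
            rw [hτ, Equiv.swap_apply_right, Equiv.swap_apply_of_ne_of_ne hya hyx] at h1
            exact absurd (hπ.trans h1) hc'
        · rw [hτ, Equiv.swap_apply_of_ne_of_ne hxa hxb] at h1 ⊢
          by_cases hya : y = a
          · subst hya
            rw [Equiv.swap_apply_left] at h1
            exact absurd (h1.trans hπ) hc'
          by_cases hyb : y = b
          · subst hyb
            rw [Equiv.swap_apply_right]
            exact hσ.trans h2
          · rw [Equiv.swap_apply_of_ne_of_ne hya hyb] at h1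
            exact absurd h1 hc'
      · intro e
        have e1 : τ x = b := congrArg Prod.fst e
        have e2 : τ y = a := congrArg Prod.snd e
        have e3 : x = a := by rw [← hττ x, e1, hτ, Equiv.swap_apply_right]
        have e4 : y = b := by rw [← hττ y, e2, hτ, Equiv.swap_apply_left]
        subst e3 e4
        exact absurd h2 hσ.asymm
  -- A moved pair cannot collide with another pair of `A`: swapping back would make it a
  -- disagreement of `π`, and it would not have been moved.
  · have aux : ∀ p ∈ A, ∀ q ∈ A, p ∉ C → p ≠ q → q = (τ p.1, τ p.2) → False := by
      rintro ⟨x, y⟩ hp q hq hpC - rfl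
      replace hp := (mem_filter.1 hp).2
      replace hq := (mem_filter.1 hq).2
      simp only [Prefers, Equiv.trans_apply, hττ] at hp hq
      exact hpC (by simp [hC, Prefers, hq.1, hp.2])
    rintro p hp q hq e
    simp only [φ] at e
    rw [mem_coe] at hp hq
    by_contra hne
    split_ifs at e with h1 h2 h2
    · exact hne e
    · exact aux q hq p hp h2 (Ne.symm hne) e
    · exact aux p hp q hq h1 hne e.symm
    · refine hne (Prod.ext ?_ ?_)
      · exact τ.injective (congrArg Prod.fst e)
      · exact τ.injective (congrArg Prod.snd e)

theorem exists_score_eq_optScore (R : Profile m n) : ∃ π, score R π = optScore R :=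
  Nat.sInf_mem (Set.range_nonempty (score R))

theorem optScore_le (R : Profile m n) (π : Ranking m) : optScore R ≤ score R π :=
  Nat.sInf_le ⟨π, rfl⟩

/-- Exchanging a pair ranked against unanimity lowers the distance to every vote. Hence the
restriction to unanimity-respecting words does not lose the optimum. -/
theorem respectsUnanimity_of_score_eq (hn : 0 < n) {R : Profile m n} {π : Ranking m}
    (h : score R π = optScore R) : RespectsUnanimity R π := by
  intro a b hab
  by_contra hlt
  have hne : a ≠ b := by
    rintro rfl
    exact lt_irrefl _ (hab ⟨0, hn⟩)
  have hba : π b < π a := lt_of_le_of_ne (not_lt.1 hlt) fun e => hne (π.injective e).symm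
  have h1 : score R ((Equiv.swap a b).trans π) < score R π :=
    sum_lt_sum_of_nonempty ⟨⟨0, hn⟩, mem_univ _⟩ fun i _ => ktDist_swap_lt (hab i) hba
  have := optScore_le R ((Equiv.swap a b).trans π)
  omega

/-! ### The number of reachable sets -/

theorem exists_width_eq_pathwidth {V : Type} [Fintype V] (G : SimpleGraph V) :
    ∃ (t : ℕ) (D : PathDecomposition G t), D.width = pathwidth G := by
  refine Nat.sInf_mem (s := {w | ∃ (t : ℕ) (D : PathDecomposition G t), D.width = w}) ?_
  refine ⟨_, 1, ⟨fun _ => univ, fun v => ⟨0, mem_univ _⟩, fun u v _ => ⟨0, mem_univ _, mem_univ _⟩,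
    fun _ _ _ _ _ _ _ _ => mem_univ _⟩, rfl⟩

/-- Cliques are contained in bags: there are at most `|V| * 2 ^ (w + 1) + 1` of them. -/
theorem card_cliques_le {V : Type} [Fintype V] [DecidableEq V] (G : SimpleGraph V)
    (S : Finset (Finset V)) (hS : ∀ A ∈ S, ∀ u ∈ A, ∀ v ∈ A, u ≠ v → G.Adj u v) :
    #S ≤ Fintype.card V * 2 ^ (pathwidth G + 1) + 1 := by
  obtain ⟨t, D, hD⟩ := exists_width_eq_pathwidth G
  have hbag : ∀ i, #(D.bag i) ≤ pathwidth G + 1 := by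
    intro i
    have h1 : #(D.bag i) ≤ univ.sup fun i => #(D.bag i) :=
      le_sup (f := fun i => #(D.bag i)) (mem_univ i)
    have h2 : (univ.sup fun i => #(D.bag i)) - 1 = pathwidth G := hD
    omega
  have hlast : ∀ v, ∃ i, v ∈ D.bag i ∧ ∀ j, v ∈ D.bag j → j ≤ i := by
    intro v
    obtain ⟨i₀, hi₀⟩ := D.cover v
    obtain ⟨i, hi, hmax⟩ := (univ.filter fun i => v ∈ D.bag i).exists_max_image id
      ⟨i₀, by simpa using hi₀⟩
    exact ⟨i, by simpa using hi, fun j hj => hmax j (by simpa using hj)⟩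
  choose last hmem hmax using hlast
  have hsub : S ⊆ insert ∅ (univ.biUnion fun v => (D.bag (last v)).powerset) := by
    intro A hA
    rcases A.eq_empty_or_nonempty with rfl | hne
    · exact mem_insert_self _ _
    -- Take `v` in the clique whose last bag comes first. Any other `u` shares a bag with `v`, not
    -- after that bag, and has its own last bag not before it; by convexity `u` lies in the last bag
    -- of `v`.
    obtain ⟨v, hv, hmin⟩ := A.exists_min_image last hne
    refine mem_insert_of_mem (mem_biUnion.2 ⟨v, mem_univ _, mem_powerset.2 fun u hu => ?_⟩)
    by_cases huv : u = v
    · exact huv ▸ hmem v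
    obtain ⟨i, hui, hvi⟩ := D.edge u v (hS A hA u hu v hv huv)
    rcases (hmax v i hvi).eq_or_lt with rfl | h1
    · exact hui
    rcases (hmin u hu).eq_or_lt with h2 | h2
    · exact h2 ▸ hmem u
    · exact D.convex i _ _ h1 h2 u hui (hmem u)
  refine (card_le_card hsub).trans ((card_insert_le _ _).trans (Nat.add_le_add_right ?_ 1))
  refine card_biUnion_le.trans ((sum_le_card_nsmul _ _ (2 ^ (pathwidth G + 1)) fun v _ => ?_).trans ?_)
  · rw [card_powerset]
    exact Nat.pow_le_pow_right (by norm_num) (hbag _)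
  · simp [card_univ]

open Classical in
/-- The maximal elements of `D` in the unanimity order. -/
noncomputable def maximalIn (R : Profile m n) (D : Finset ℕ) : Finset (Fin m) :=
  univ.filter fun c => (c : ℕ) ∈ D ∧ ∀ d : Fin m, (d : ℕ) ∈ D → ¬ Unanimous R c d

theorem unanimous_trans {R : Profile m n} {a b c : Fin m} (h : Unanimous R a b)
    (h' : Unanimous R b c) : Unanimous R a c := fun i => (h i).trans (h' i)

/-- A reachable set is the down-closure of its maximal elements. -/
theorem mem_iff_maximalIn (hn : 0 < n) {R : Profile m n} {D : Finset ℕ} {l : List ℕ}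
    (h : Path m (wt R) ∅ l D) (x : Fin m) :
    (x : ℕ) ∈ D ↔ ∃ c ∈ maximalIn R D, x = c ∨ Unanimous R x c := by
  classical
  constructor
  · intro hx
    -- Among `x` and the members of `D` unanimously below it in preference, the one ranked last by
    -- the vote `0` is maximal.
    obtain ⟨c, hc, hmax⟩ := (univ.filter fun c : Fin m =>
      (c : ℕ) ∈ D ∧ (x = c ∨ Unanimous R x c)).exists_max_image (R ⟨0, hn⟩) ⟨x, by simp [hx]⟩
    simp only [mem_filter, mem_univ, true_and] at hc hmax
    refine ⟨c, ?_, hc.2⟩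
    simp only [maximalIn, mem_filter, mem_univ, true_and]
    refine ⟨hc.1, fun d hd hcd => ?_⟩
    refine absurd (hcd ⟨0, hn⟩) (not_lt.2 (hmax d ⟨hd, Or.inr ?_⟩))
    rcases hc.2 with rfl | h'
    · exact hcd
    · exact unanimous_trans h' hcd
  · rintro ⟨c, hc, hxc⟩
    simp only [maximalIn, mem_filter, mem_univ, true_and] at hc
    rcases hxc with rfl | hxc
    · exact hc.1
    · have hne : c ≠ x := by
        rintro rfl
        exact lt_irrefl _ (hxc ⟨0, hn⟩)
      exact h.mem_of_unanimous hc.1 x.2 (fun e => hne (Fin.ext e).symm)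
        ((wt_eq_zero_iff R hne).2 hxc)

/-- Taking maximal elements is injective on reachable sets, and its values are cliques of the
complement of the unanimity graph. -/
theorem length_le_of_reachable (hn : 0 < n) (R : Profile m n) {lst : List (Finset ℕ)}
    (hnd : lst.Nodup) (hl : ∀ D ∈ lst, ∃ l, Path m (wt R) ∅ l D) :
    lst.length ≤ m * 2 ^ (unanimityWidth R + 1) + 1 := by
  classical
  rw [← List.toFinset_card_of_nodup hnd]
  have hinj : Set.InjOn (maximalIn R) (lst.toFinset : Set (Finset ℕ)) := by
    intro D hD E hE e
    obtain ⟨l, hl₁⟩ := hl D (by simpa using hD)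
    obtain ⟨l', hl₂⟩ := hl E (by simpa using hE)
    ext x
    by_cases hx : x < m
    · have h1 := mem_iff_maximalIn hn hl₁ ⟨x, hx⟩
      have h2 := mem_iff_maximalIn hn hl₂ ⟨x, hx⟩
      rw [e] at h1
      exact h1.trans h2.symm
    · exact ⟨fun h => absurd (mem_range.1 (hl₁.subset h)) hx,
        fun h => absurd (mem_range.1 (hl₂.subset h)) hx⟩
  rw [← card_image_of_injOn hinj]
  refine (card_cliques_le (unanimityGraph R)ᶜ _ ?_).trans_eq (by simp [unanimityWidth])
  intro A hA u hu v hv huv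
  obtain ⟨D, -, rfl⟩ := mem_image.1 hA
  simp only [maximalIn, mem_filter, mem_univ, true_and] at hu hv
  rw [SimpleGraph.compl_adj]
  refine ⟨huv, fun h => ?_⟩
  rcases h.2 with h | h
  · exact hu.2 v hv.1 h
  · exact hv.2 u hu.1 h

/-! ### Good words and approximate rankings -/

/-- The threshold that the program computes from the optimal gain `best`. -/
def threshold (p q tot best : ℕ) : ℕ := tot - p * (tot - best) / q

/-- As the score is an integer, `q * sc ≤ p * opt` means `sc ≤ p * opt / q` with the quotient
rounded down; truncation of the outer subtraction is harmless because gains are non-negative. -/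
theorem threshold_le_iff {p q tot best g sc opt : ℕ} (hq : 0 < q) (hg : g + sc = tot)
    (hb : best + opt = tot) : threshold p q tot best ≤ g ↔ q * sc ≤ p * opt := by
  rw [threshold, show tot - best = opt by omega, mul_comm q, ← Nat.le_div_iff_mul_le hq]
  omega

theorem score_le_iff (I : Instance) (π : Ranking I.m) :
    (score I.votes π : ℚ) ≤ I.lam * (optScore I.votes : ℚ) ↔
      I.lam.den * score I.votes π ≤ I.lam.num.toNat * optScore I.votes := by
  have hnum : (0 : ℤ) ≤ I.lam.num := Rat.num_nonneg.2 (zero_le_one.trans I.one_le_lam)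
  have hlam : I.lam = (I.lam.num.toNat : ℚ) / I.lam.den := by
    conv_lhs => rw [← Rat.num_div_den I.lam]
    congr 1
    exact_mod_cast (Int.toNat_of_nonneg hnum).symm
  have hden : (0 : ℚ) < I.lam.den := by exact_mod_cast I.lam.den_pos
  conv_lhs => rw [hlam]
  rw [div_mul_eq_mul_div, le_div_iff₀ hden, mul_comm (score I.votes π : ℚ)]
  exact_mod_cast Iff.rfl

/-- If the table entry of the full set is right, the words above the threshold are the approximate
rankings. -/
theorem goodWords_eq_image (I : Instance) {lst : List (Finset ℕ)} {tab : Finset ℕ → ℕ}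
    (ht : TableOK I.m I.n (wt I.votes) lst tab) :
    goodWords I.m (wt I.votes) (threshold I.lam.num.toNat I.lam.den
      (I.n * (I.m * (I.m - 1) / 2)) (tab (range I.m) - 1)) =
      Ranking.toWord '' I.approxRankings := by
  set tot := I.n * (I.m * (I.m - 1) / 2) with htot
  have hsum := fun π => gainSum_add_score I.votes π
  have hpath := fun π => path_toWord I.n_pos I.votes π
  -- Completeness, applied to an optimal ranking, makes the entry large enough; soundness provides a
  -- ranking attaining it.
  have hbest : tab (range I.m) - 1 + optScore I.votes = tot := by
    obtain ⟨π, hπ⟩ := exists_score_eq_optScore I.votes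
    have hp := (hpath π).2 (respectsUnanimity_of_score_eq I.n_pos hπ)
    have h1 := ht.complete _ _ hp (by simp)
    obtain ⟨w, hw, hv⟩ := ht.inv.sound (range I.m) (by omega)
    obtain ⟨σ, rfl⟩ := exists_toWord hw
    have h2 := hsum π
    have h3 := hsum σ
    have h4 := optScore_le I.votes σ
    omega
  ext w
  constructor
  · rintro ⟨hw, hthr⟩
    obtain ⟨π, rfl⟩ := exists_toWord hw
    exact ⟨π, ⟨(hpath π).1 hw,
      (score_le_iff I π).2 ((threshold_le_iff I.lam.den_pos (hsum π) hbest).1 hthr)⟩, rfl⟩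
  · rintro ⟨π, ⟨h1, h2⟩, rfl⟩
    exact ⟨(hpath π).2 h1,
      (threshold_le_iff I.lam.den_pos (hsum π) hbest).2 ((score_le_iff I π).1 h2)⟩

theorem approxRankings_nonempty (I : Instance) : I.approxRankings.Nonempty := by
  obtain ⟨π, hπ⟩ := exists_score_eq_optScore I.votes
  refine ⟨π, respectsUnanimity_of_score_eq I.n_pos hπ, ?_⟩
  rw [hπ]
  exact le_mul_of_one_le_left (by positivity) I.one_le_lam

/-- A list of words that is complete in the sense of the enumeration comes from a solution. -/
theorem exists_solution (I : Instance) {E : List (List ℕ)}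
    (hE : LevelInv (Ranking.toWord '' I.approxRankings) I.r 0 E) :
    ∃ L : List (Ranking I.m), I.IsSolution L ∧ L.map Ranking.toWord = E := by
  obtain ⟨hmem, hlen⟩ := hE.length_eq (Set.toFinite _)
  rw [Set.ncard_image_of_injective _ toWord_injective] at hlen
  have : ∀ l ∈ E, ∃ π ∈ I.approxRankings, Ranking.toWord π = l := hmem
  have hnd := hE.nodup
  obtain ⟨L, hL, rfl⟩ : ∃ L : List (Ranking I.m), (∀ π ∈ L, π ∈ I.approxRankings) ∧
      L.map Ranking.toWord = E := by
    clear hlen hmem hnd hE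
    induction E with
    | nil => exact ⟨[], by simp, rfl⟩
    | cons l E ih =>
      obtain ⟨π, hπ, rfl⟩ := this l (by simp)
      obtain ⟨L, hL, rfl⟩ := ih fun l' hl' => this l' (by simp [hl'])
      exact ⟨π :: L, by simpa using ⟨hπ, hL⟩, rfl⟩
  refine ⟨L, ⟨hnd.of_map _, hL, by simpa using hlen⟩, rfl⟩

/-! ### The algorithm -/

/-- The algorithm for distinct approximate Kemeny ranking aggregation. -/
def kemenyProg : Prog :=
  .set 0 (.load 0 (.const 0)) ;; .set 1 (.load 0 (.const 1)) ;; .set 2 (.load 0 (.const 2)) ;;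
  majProg ;; powersOfTwo ;; tableProg ;; thresholdProg ;; enumProg ;; outputProg

/-- The running time of the algorithm in units, if there are at most `M` reachable sets. -/
def kemenyTime (m n r M : ℕ) : ℕ :=
  1 + (1 + (1 + ((m * (m * (n * 3 + 4) + 4) + 2) + (4 * (m + 1) + (tableTime m M +
    (3 + ((m * (levelTime m r + 2) + 7) + (r * (m * 4 + 5) + 4))))))))

/-! ### The size of the input and of the numbers computed -/

theorem length_encode (I : Instance) : I.encode.length = 5 + I.n * I.m := by
  simp [Instance.encode, Ranking.toWord, List.length_flatten, List.map_ofFn, Function.comp_def]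
  omega

theorem getD_encode (I : Instance) {i p : ℕ} (hi : i < I.n) (hp : p < I.m) :
    I.encode.getD (5 + (i * I.m + p)) 0 = voteEntry I.votes i p := by
  have h1 : ∀ l ∈ List.ofFn fun i => Ranking.toWord (I.votes i), l.length = I.m := by
    intro l hl
    obtain ⟨j, rfl⟩ := (List.mem_ofFn' _ _).1 hl
    simp [Ranking.toWord]
  have h2 := getElem?_flatten h1 (j := i) (by simpa using hi) hp
  rw [List.getD_eq_getElem?_getD, Instance.encode, List.getElem?_append_right (by simp)]
  simp only [List.length_cons, List.length_nil, Nat.reduceAdd, Nat.add_sub_cancel_left]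
  rw [h2]
  simp [Ranking.toWord, voteEntry, hi, hp]

theorem len_le_inputSize {l : List ℕ} {v : ℕ} (h : v ∈ l) : len v ≤ inputSize l :=
  List.single_le_sum (by simp) _ (List.mem_map_of_mem h)

theorem lt_two_pow_inputSize {l : List ℕ} {v : ℕ} (h : v ∈ l) : v < 2 ^ inputSize l := by
  have h1 := len_le_inputSize h
  exact Nat.size_le.1 (by unfold len at h1; omega)

theorem length_le_inputSize (l : List ℕ) : l.length ≤ inputSize l := by
  induction l with
  | nil => simp
  | cons v l ih =>
    simp only [inputSize, List.map_cons, List.sum_cons, List.length_cons, len] at ih ⊢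
    omega

/-- The `n * m` vote entries give `n * m ≤ N`, and `m ≤ N` as there is a vote. The quadratic term is
needed for the codes, as `m ^ m ≤ 2 ^ (m * m)`; the addresses of suffixes involve `r`, which may be
as large as `2 ^ N` up to a constant but has few bits. -/
theorem bounds_of_size (I : Instance) {N : ℕ} (hN : N = inputSize I.encode) :
    I.m ≤ N ∧ I.m * I.n ≤ N ∧ Bounds (N ^ 2 + 2 * N + 4) I.m I.n I.r ∧
      Good (N ^ 2 + 2 * N + 4) (start I.encode) := by
  have hlen : 5 + I.n * I.m ≤ N := by
    rw [hN, ← length_encode]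
    exact length_le_inputSize _
  have hm1 : I.m ≤ I.n * I.m := Nat.le_mul_of_pos_left _ I.n_pos
  have hm : I.m ≤ N := by omega
  have hmm : I.m * I.m ≤ N ^ 2 := by
    rw [sq]
    exact Nat.mul_le_mul hm hm
  have hr : I.r < 2 ^ N := hN ▸ lt_two_pow_inputSize (by simp [Instance.encode])
  refine ⟨hm, by rw [mul_comm]; omega, ⟨by positivity, ?_, ?_, ?_, ?_⟩, fun x => ?_, fun a i => ?_⟩
  · rw [← pow_succ]
    exact Nat.pow_lt_pow_right (by norm_num) (by nlinarith)
  · have h1 : I.n * I.m * I.m ≤ N ^ 2 := by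
      rw [sq]
      exact Nat.mul_le_mul (by omega) hm
    have := Nat.lt_two_pow_self (n := N ^ 2 + 2 * N + 4)
    omega
  · have h1 : (I.m + 1) * (I.r + 1) ≤ 2 ^ I.m * 2 ^ N :=
      Nat.mul_le_mul Nat.lt_two_pow_self hr
    rw [← pow_add] at h1
    refine h1.trans_lt (Nat.pow_lt_pow_right (by norm_num) ?_)
    omega
  · have h1 : I.m ^ I.m ≤ 2 ^ (I.m * I.m) := by
      rw [pow_mul]
      exact Nat.pow_le_pow_left Nat.lt_two_pow_self.le _
    have h2 : I.m ^ I.m * 2 ≤ 2 ^ (I.m * I.m + 1) := by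
      rw [pow_succ]; omega
    exact h2.trans_lt (Nat.pow_lt_pow_right (by norm_num) (by omega))
  · exact Nat.two_pow_pos _
  · simp only [start]
    split_ifs
    · by_cases h : i < I.encode.length
      · rw [List.getD_eq_getElem _ _ h]
        refine (lt_two_pow_inputSize (List.getElem_mem h)).trans_le ?_
        rw [← hN]
        exact Nat.pow_le_pow_right (by norm_num) (by omega)
      · rw [List.getD_eq_default _ _ (by omega)]
        exact Nat.two_pow_pos _
    · exact Nat.two_pow_pos _

theorem ev_kemenyProg (I : Instance) {B : ℕ} (hb : Bounds B I.m I.n I.r) :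
    Ev B kemenyProg (start I.encode)
      (kemenyTime I.m I.n I.r (I.m * 2 ^ (unanimityWidth I.votes + 1) + 1))
      (fun s' => ∃ L, I.IsSolution L ∧
        s'.Outputs (L.length :: (L.map Ranking.toWord).flatten)) := by
  set M := I.m * 2 ^ (unanimityWidth I.votes + 1) + 1 with hM
  have hin : ∀ (s : State), s.arr 0 = (start I.encode).arr 0 → ∀ i < I.n, ∀ p < I.m,
      s.arr 0 (5 + (i * I.m + p)) = voteEntry I.votes i p := by
    intro s hs i hi p hp
    rw [hs]
    simpa [start] using getD_encode I hi hp
  refine Ev.setSeq hb.pos (by decide) (fun hg => hg.arr 0 _) (Ev.setSeq hb.pos (by decide)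
    (fun hg => hg.arr 0 _) (Ev.setSeq hb.pos (by decide) (fun hg => hg.arr 0 _) ?_))
  set s₀ := State.setReg _ _ _ with hs₀
  have a0 : s₀.reg 0 = I.m := by simp [hs₀, Expr.eval, start, Instance.encode]
  have a1 : s₀.reg 1 = I.n := by simp [hs₀, Expr.eval, start, Instance.encode]
  have a2 : s₀.reg 2 = I.r := by simp [hs₀, Expr.eval, start, Instance.encode]
  have aarr : s₀.arr = (start I.encode).arr := by simp [hs₀]
  refine Ev.seq ((ev_majProg hb a0 a1 (fun i hi p hp => voteEntry_lt I.votes hi hp)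
    (hin s₀ (by rw [aarr])) (by rw [aarr]; simp [start])).frame.mono le_rfl ?_)
  rintro s₁ ⟨F₁, hmaj⟩
  have b0 : s₁.reg 0 = I.m := by rw [F₁.reg 0 (by decide), a0]
  refine Ev.seq ((ev_powersOfTwo hb b0).frame.mono le_rfl ?_)
  rintro s₂ ⟨F₂, hpow⟩
  have hc₂ : Ctx I.m (wt I.votes) s₂ := by
    refine ⟨by rw [F₂.reg 0 (by decide), b0], fun a ha b hb => ?_, hpow⟩
    rw [F₂.arr 2 (by decide), hmaj a ha b hb, sum_voteEntry I.votes ha hb]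
  refine Ev.seq ((ev_tableProg hb (wt_le I.votes) (M := M) (fun lst tab h =>
    length_le_of_reachable I.n_pos I.votes h.nodup fun D hD => h.reachable hD) hc₂ ?_).frame.mono
    le_rfl ?_)
  · intro i
    rw [F₂.arr 4 (by decide), F₁.arr 4 (by decide), aarr]
    simp [start]
  rintro s₃ ⟨F₃, hc₃, lst, tab, hinv, hrel, hcomp⟩
  have ht : TableOK I.m I.n (wt I.votes) lst tab := ⟨wt_le I.votes, hinv, hcomp⟩
  have d1 : s₃.reg 1 = I.n := by
    rw [F₃.reg 1 (by decide), F₂.reg 1 (by decide), F₁.reg 1 (by decide), a1]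
  have d2 : s₃.reg 2 = I.r := by
    rw [F₃.reg 2 (by decide), F₂.reg 2 (by decide), F₁.reg 2 (by decide), a2]
  have darr : s₃.arr 0 = (start I.encode).arr 0 := by
    rw [F₃.arr 0 (by decide), F₂.arr 0 (by decide), F₁.arr 0 (by decide), aarr]
  refine Ev.seq ((ev_thresholdProg hb hc₃ d1).frame.mono le_rfl ?_)
  rintro s₄ ⟨F₄, h3⟩
  have e3 : s₄.reg 3 = threshold I.lam.num.toNat I.lam.den
      (I.n * (I.m * (I.m - 1) / 2)) (tab (range I.m) - 1) := by
    rw [h3, hrel.tab, darr]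
    simp [start, Instance.encode, threshold]
  -- From here on the enumerated words are the approximate rankings themselves.
  have hK := goodWords_eq_image I ht
  rw [← e3] at hK
  have hs₄ : EnumCtx I.m (wt I.votes) tab (s₄.reg 3) I.r s₄ := by
    refine ⟨hc₃.frame F₄ (by decide) (by decide) (by decide), ?_, rfl, ?_⟩
    · rw [F₄.arr 4 (by decide)]; exact hrel.tab
    · rw [F₄.reg 2 (by decide), d2]
  refine Ev.seq ((ev_enumProg hb ht hs₄ I.r_pos ?_).mono le_rfl ?_)
  · rw [hK]
    exact (approxRankings_nonempty I).image _
  rintro s₅ ⟨hs₅, lo, E, hlev, hE, hlo, h40, h41⟩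
  have hEm : ∀ l ∈ E, l.length = I.m ∧ ∀ c ∈ l, c < I.m := by
    intro l hl
    obtain ⟨u, hu, huK⟩ := hlev.suffix l hl
    rw [List.length_eq_zero_iff.1 hu, List.nil_append] at huK
    exact ⟨by rw [← huK.1.card, card_range], huK.1.nodup.2.2⟩
  refine (ev_outputProg hb (W := wt I.votes) hs₅.reg hE hEm hlev.length_le hlo h40 h41).mono
    le_rfl ?_
  intro s₆ hout
  rw [hK] at hlev
  obtain ⟨L, hL, rfl⟩ := exists_solution I hlev
  exact ⟨L, hL, by simpa using hout⟩

/-- The factor of the running time that is polynomial in the input size. -/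
noncomputable def timePoly : Polynomial ℕ :=
  let X : Polynomial ℕ := .X
  (6 + (X * (7 * X + 4) + 2) + (4 * X + 4) +
    (5 + X * ((2 * X + 1) * (X * (9 * X + 25) + 5) + 5)) +
    (X * (X * (9 * X + 24) + 14) + 7) + (4 * X + 9)) * (1000 * (X ^ 2 + 2 * X + 4) ^ 2)

/-- Each summand involves at most one of the factors `2 ^ w` and `r`, and `Z` dominates both as well
as 1. -/
theorem kemenyTime_le {m n r w N : ℕ} (hm : m ≤ N) (hmn : m * n ≤ N) (hr : 0 < r) :
    kemenyTime m n r (m * 2 ^ (w + 1) + 1) * unitCost (N ^ 2 + 2 * N + 4) ≤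
      2 ^ w * r * timePoly.eval N := by
  set Z := 2 ^ w * r with hZ
  have hw := Nat.two_pow_pos w
  have hZ1 : 1 ≤ Z := Nat.mul_pos hw hr
  have hrZ : r ≤ Z := Nat.le_mul_of_pos_left _ hw
  have hwZ : 2 ^ w ≤ Z := Nat.le_mul_of_pos_right _ hr
  have hM : m * 2 ^ (w + 1) + 1 ≤ Z * (2 * N + 1) := by
    calc m * 2 ^ (w + 1) + 1 = 2 * (m * 2 ^ w) + 1 := by ring
      _ ≤ 2 * (N * Z) + Z := by gcongr
      _ = _ := by ring
  have h1 : m * (m * (n * 3 + 4) + 4) + 2 ≤ Z * (N * (7 * N + 4) + 2) := by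
    calc m * (m * (n * 3 + 4) + 4) + 2 = m * (3 * (m * n) + 4 * m + 4) + 2 := by ring
      _ ≤ N * (3 * N + 4 * N + 4) + 2 := by gcongr
      _ = 1 * (N * (7 * N + 4) + 2) := by ring
      _ ≤ _ := Nat.mul_le_mul_right _ hZ1
  have h2 : 4 * (m + 1) ≤ Z * (4 * N + 4) := by
    calc 4 * (m + 1) ≤ 4 * (N + 1) := by gcongr
      _ = 1 * (4 * N + 4) := by ring
      _ ≤ _ := Nat.mul_le_mul_right _ hZ1
  have h3 : tableTime m (m * 2 ^ (w + 1) + 1) ≤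
      Z * (5 + N * ((2 * N + 1) * (N * (9 * N + 25) + 5) + 5)) := by
    calc tableTime m (m * 2 ^ (w + 1) + 1)
        ≤ 5 * Z + N * (Z * (2 * N + 1) * (N * (9 * (N + 1) + 16) + 5) + 5 * Z) := by
          unfold tableTime
          gcongr <;> omega
      _ = _ := by ring
  have h4 : m * (levelTime m r + 2) + 7 ≤ Z * (N * (N * (9 * N + 24) + 14) + 7) := by
    calc m * (levelTime m r + 2) + 7
        ≤ N * (Z * (N * (9 * (N + 1) + 15) + 6) + 6 * Z + 2 * Z) + 7 * Z := by
          unfold levelTime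
          gcongr <;> omega
      _ = _ := by ring
  have h5 : r * (m * 4 + 5) + 4 ≤ Z * (4 * N + 9) := by
    calc r * (m * 4 + 5) + 4 ≤ Z * (N * 4 + 5) + 4 * Z := by gcongr; omega
      _ = _ := by ring
  have h : kemenyTime m n r (m * 2 ^ (w + 1) + 1) ≤
      Z * (6 + (N * (7 * N + 4) + 2) + (4 * N + 4) +
        (5 + N * ((2 * N + 1) * (N * (9 * N + 25) + 5) + 5)) +
        (N * (N * (9 * N + 24) + 14) + 7) + (4 * N + 9)) := by
    unfold kemenyTime
    rw [mul_add Z, mul_add Z, mul_add Z, mul_add Z, mul_add Z]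
    omega
  have he : timePoly.eval N = (6 + (N * (7 * N + 4) + 2) + (4 * N + 4) +
      (5 + N * ((2 * N + 1) * (N * (9 * N + 25) + 5) + 5)) +
      (N * (N * (9 * N + 24) + 14) + 7) + (4 * N + 9)) * (1000 * (N ^ 2 + 2 * N + 4) ^ 2) := by
    simp [timePoly]
  rw [he, ← mul_assoc]
  exact Nat.mul_le_mul_right _ h

theorem solvedInTime_kemenyProg : distinctApproxKemeny.SolvedInTime kemenyProg fun I =>
    2 ^ unanimityWidth I.votes * I.r * timePoly.eval (distinctApproxKemeny.size I) := by
  intro I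
  obtain ⟨hm, hmn, hb, hg⟩ := bounds_of_size I rfl
  obtain ⟨s, t, h1, h2, -, L, hL, hout⟩ := ev_kemenyProg I hb hg
  exact ⟨s, t, h1, h2.trans (kemenyTime_le hm hmn I.r_pos), L, hL, hout⟩

theorem computable_two_pow_mul : Computable fun x : ℕ × ℕ => 2 ^ x.1 * x.2 := by
  have hpow : Primrec fun k : ℕ => 2 ^ k := by
    refine (Primrec.nat_rec₁ 1 (Primrec.nat_mul.comp (.const 2) .snd).to₂).of_eq fun k => ?_
    induction k with
    | zero => rfl
    | succ k ih => rw [pow_succ, mul_comm, ← ih]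
  exact (Primrec.nat_mul.comp (hpow.comp .fst) .snd).to_comp

end Kemeny

theorem mainTheorem10 :
    ∃ A : RAM.Prog,
      Kemeny.distinctApproxKemeny.IsFPTAlgorithm A
        (fun I : Kemeny.Instance => (Kemeny.unanimityWidth I.votes, I.r)) ∧
      ∃ c : ℕ, Kemeny.distinctApproxKemeny.SolvedInOStar A
        (fun I : Kemeny.Instance => 2 ^ (c * Kemeny.unanimityWidth I.votes) * I.r) := by
  -- The same bound serves both claims, with the computable function `2 ^ w * r` and with `c = 1`;
  -- the factor 2 from the bag size `w + 1` is absorbed by the polynomial.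
  refine ⟨Kemeny.kemenyProg, ⟨_, Kemeny.computable_two_pow_mul, Kemeny.timePoly,
    Kemeny.solvedInTime_kemenyProg⟩, 1, Kemeny.timePoly, ?_⟩
  simpa only [one_mul] using Kemeny.solvedInTime_kemenyProg
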